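/- **Setting.** Let $V$ and $U$ be real separable Hilbert spaces, $V'$ the topological dual of $V$ (not identified with $V$), and $\langle\cdot,\cdot\rangle$ the duality pairing between $V'$ and $V$; the bidual $V''$ is identified with $V$. For a Banach space $X$ let $\Sigma_0(X)$ be the set of convex, Fréchet differentiable $w:X\to\mathbb R$ with Lipschitz continuous derivative. For $h:U\to\mathbb R$ convex put $\partial h(u)=\{\varphi\in U:\ h(v)-h(u)\ge(\varphi\,|\,v-u)_U\ \forall v\in U\}$ and $h^*(x)=\sup_{y\in U}\{(x\,|\,y)_U-h(y)\}$. Let $p>1$, $\omega,\lambda\in\mathbb R$, and assume: 1. $A:D(A)\subset V'\to V'$ generates a strongly continuous semigroup $\{e^{\tau A}\}_{\tau\ge0}$ on $V'$ with $|e^{\tau A}x|_{V'}\le e^{\omega\tau}|x|_{V'}$ for all $\tau\ge 0$, $x\in V'$; 2. $B:U\to V'$ is linear and continuous; 3. $g_0\in\Sigma_0(V')$; 4. $h_0:U\to\mathbb R$ is convex and lower semicontinuous, and $\partial h_0$ is injective (that is, $\partial h_0(u)\cap\partial h_0(v)=\emptyset$ for $u\neq v$); 5. $h_0^*$ is finite,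 $h_0^*(0)=0$ and $h_0^*\in\Sigma_0(U)$; 6. there are $a>0$, $b\in\mathbb R$ with $h_0(u)\ge a|u|_U^p+b$ for all $u\in U$; 7. $\lambda>\omega$. For $r\geq 1$, $t\ge0$ and a Banach space $E$, $L^r_\lambda(t,+\infty;E)$ is the space of $f:[t,+\infty)\to E$ with $\tau\mapsto e^{-\lambda\tau/r}f(\tau)\in L^r(t,+\infty;E)$. For $t\ge0$ and $x\in V'$, a pair $(u,y)$ is *admissible* at $(t,x)$ if $u\in L^p_\lambda(t,+\infty;U)$, $y\in L^1_{loc}(t,+\infty;V')$ is the mild solution of $y'=Ay+Bu$, $y(t)=x$, i.e. $$y(\tau)=e^{(\tau-t)A}x+\int_t^\tau e^{(\tau-\sigma)A}Bu(\sigma)\,d\sigma,\qquad \tau\ge t,$$ and the cost $$J(t,x,u)=\int_t^{+\infty}e^{-\lambda\tau}\,[g_0(y(\tau))+h_0(u(\tau))]\,d\tau$$ is well defined in $[-\infty,+\infty]$ (the positive or the negative part of the integrand has finite integral; this is automatic when $\lambda>0$ and $p\ge 2$, $\lambda>2\omega$). It is *optimal* at $(t,x)$ if it is admissible and its cost is less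 than or equal to that of every admissible pair at $(t,x)$. Let $B^*:V\to U$ be the adjoint of $B$, $(u\,|\,B^*v)_U=\langle Bu,v\rangle$; let $g_0'(\cdot)\in V$ be the derivative of $g_0$; and let $e^{\tau A_1^*}:V\to V$ be the adjoint of $e^{\tau A}$ in the duality, $\langle e^{\tau A}\varphi,v\rangle=\langle\varphi,e^{\tau A_1^*}v\rangle$. A function $\pi:[t,+\infty)\to V$ satisfies, along with $u$ and $y$, the system (CO) at $(t,x)$ if * $y$ is the mild solution of $y'=Ay+Bu$, $y(t)=x$; * $\pi$ is the mild solution of $\pi'=(\lambda-A_1^*)\pi-g_0'(y)$ with the transversality condition $\lim_{T\to+\infty}e^{(\omega-\lambda)T}\pi(T)=0$: this limit relation holds, and for every $\tau\ge t$ $$\pi(\tau)=\int_\tau^{+\infty}e^{-\lambda(\sigma-\tau)}e^{(\sigma-\tau)A_1^*}g_0'(y(\sigma))\,d\sigma ,$$ where the integrand is integrable; * $-B^*\pi(\tau)\in\partial h_0(u(\tau))$ for almost every $\tau\ge t$. **Theorem (Maximum Principle).** Under the assumptions above, let $p\ge2$, $q=\frac p{p-1}$, $\lambda>\max(2\omega,\omega)$,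 $t\ge0$ and $x\in V'$. (i) Let $(u,y)$ be an admissible pair at $(t,x)$. If there exists $\pi\in L^q_\lambda(t,+\infty;V)$ satisfying, along with $u$ and $y$, the system (CO), then $(u,y)$ is optimal at $(t,x)$. (ii) Assume further that either $p>2$ and $\lambda>0$, or $p=2$, $\lambda>0$ and $\omega<0$. Then every pair $(u^*,y^*)$ optimal at $(t,x)$ admits a $\pi\in L^q_\lambda(t,+\infty;V)$ satisfying, along with $u^*$ and $y^*$, the system (CO). -/

import Mathlib

open MeasureTheory Set Filter Topology
open scoped NNReal ENNReal RealInnerProductSpace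

noncomputable section

namespace BoundaryControl

/-! ### Semigroups and their generators -/

section Semigroup

variable {X : Type*} [NormedAddCommGroup X] [NormedSpace ℝ X]

/-- `S τ`, `τ ≥ 0`, is a strongly continuous semigroup of bounded operators on `X`
(the values at negative times are irrelevant). -/
structure IsC0Semigroup (S : ℝ → X →L[ℝ] X) : Prop where
  map_zero : S 0 = ContinuousLinearMap.id ℝ X
  map_add : ∀ s τ : ℝ, 0 ≤ s → 0 ≤ τ → S (s + τ) = (S s).comp (S τ)
  continuousOn : ∀ x : X, ContinuousOn (fun τ => S τ x) (Ici 0)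

/-- The possibly unbounded operator `A : D(A) ⊆ X → X` is the infinitesimal generator of `S`:
`x ∈ D(A)` with `A x = y` if and only if `(S τ x - x) / τ → y` as `τ ↓ 0`. -/
def IsInfinitesimalGenerator (A : X →ₗ.[ℝ] X) (S : ℝ → X →L[ℝ] X) : Prop :=
  ∀ x y : X, (x, y) ∈ A.graph ↔
    Tendsto (fun τ : ℝ => τ⁻¹ • (S τ x - x)) (𝓝[>] 0) (𝓝 y)

end Semigroup

/-! ### Convex functions -/

/-- The class `Σ₀(X)`: convex, Fréchet differentiable, with Lipschitz derivative. -/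
def MemSigmaZero {X : Type*} [NormedAddCommGroup X] [NormedSpace ℝ X] (w : X → ℝ) : Prop :=
  ConvexOn ℝ univ w ∧ Differentiable ℝ w ∧ ∃ K : ℝ≥0, LipschitzWith K (fderiv ℝ w)

/-- The subdifferential of `h` at `u`. -/
def subdiff {U : Type*} [NormedAddCommGroup U] [InnerProductSpace ℝ U] (h : U → ℝ) (u : U) :
    Set U :=
  {φ | ∀ v : U, ⟪φ, v - u⟫ ≤ h v - h u}

/-- The convex conjugate `h*(x) = sup_y (⟪x, y⟫ - h y)`; meaningful where the supremum is
finite. -/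
def conj {U : Type*} [NormedAddCommGroup U] [InnerProductSpace ℝ U] (h : U → ℝ) (x : U) : ℝ :=
  ⨆ y : U, (⟪x, y⟫ - h y)

/-! ### Duality between `V` and `V' = StrongDual ℝ V` -/

section Duality

variable {V : Type*} [NormedAddCommGroup V] [InnerProductSpace ℝ V]
variable {U : Type*} [NormedAddCommGroup U] [InnerProductSpace ℝ U] [CompleteSpace U]

section Bidual

variable [CompleteSpace V]

/-- The canonical identification of the bidual of the Hilbert space `V` with `V`: the element
`v` of `V` with `F φ = ⟨φ, v⟩` for all `φ ∈ V'`. -/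
def ofBidual (F : StrongDual ℝ (StrongDual ℝ V)) : V :=
  (InnerProductSpace.toDual ℝ V).symm
    { toFun := fun w => F (InnerProductSpace.toDual ℝ V w)
      map_add' := fun v w => by simp
      map_smul' := fun c w => by simp
      cont := F.continuous.comp (InnerProductSpace.toDual ℝ V).continuous }

theorem apply_ofBidual (F : StrongDual ℝ (StrongDual ℝ V)) (φ : StrongDual ℝ V) :
    φ (ofBidual F) = F φ := by
  obtain ⟨w, rfl⟩ := (InnerProductSpace.toDual ℝ V).surjective φ
  rw [InnerProductSpace.toDual_apply_apply, real_inner_comm, ofBidual,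
    InnerProductSpace.toDual_symm_apply]
  rfl

/-- The derivative `g'(x)` of `g : V' → ℝ`, as an element of `V`. -/
def dualGradient (g : StrongDual ℝ V → ℝ) (x : StrongDual ℝ V) : V :=
  ofBidual (fderiv ℝ g x)

/-- The adjoint `T₁* : V → V` of a bounded operator `T` on `V'` in the duality between `V'`
and `V`, characterised by `⟨T φ, v⟩ = ⟨φ, T₁* v⟩`. -/
def dualityAdjoint (T : StrongDual ℝ V →L[ℝ] StrongDual ℝ V) (v : V) : V :=
  ofBidual ((ContinuousLinearMap.apply ℝ ℝ v).comp T)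

theorem apply_dualityAdjoint (T : StrongDual ℝ V →L[ℝ] StrongDual ℝ V) (φ : StrongDual ℝ V)
    (v : V) : φ (dualityAdjoint T v) = T φ v := by
  rw [dualityAdjoint, apply_ofBidual]; rfl

end Bidual

/-- The adjoint `B* : V → U` of `B : U → V'`, characterised by `⟨B u, v⟩ = (u | B* v)`. -/
def controlAdjoint (B : U →L[ℝ] StrongDual ℝ V) (v : V) : U :=
  (InnerProductSpace.toDual ℝ U).symm (B.flip v)

theorem inner_controlAdjoint (B : U →L[ℝ] StrongDual ℝ V) (u : U) (v : V) :
    ⟪u, controlAdjoint B v⟫ = B u v := by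
  rw [real_inner_comm, controlAdjoint, InnerProductSpace.toDual_symm_apply]; rfl

end Duality

/-! ### The control problem -/

/-- The weighted space `L^r_λ(t, +∞; E)`. -/
def MemWeightedLp {E : Type*} [NormedAddCommGroup E] [NormedSpace ℝ E] (r lam t : ℝ)
    (f : ℝ → E) : Prop :=
  MemLp (fun τ => Real.exp (-(lam * τ / r)) • f τ) (ENNReal.ofReal r) (volume.restrict (Ici t))

section Problem

variable {V : Type*} [NormedAddCommGroup V] [InnerProductSpace ℝ V] [CompleteSpace V]
variable {U : Type*} [NormedAddCommGroup U] [InnerProductSpace ℝ U] [CompleteSpace U]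

/-- The standing assumptions on the data of the problem. -/
structure StandingAssumptions (A : StrongDual ℝ V →ₗ.[ℝ] StrongDual ℝ V)
    (S : ℝ → StrongDual ℝ V →L[ℝ] StrongDual ℝ V)
    (g₀ : StrongDual ℝ V → ℝ) (h₀ : U → ℝ) (p ω lam : ℝ) : Prop where
  semigroup : IsC0Semigroup S
  generator : IsInfinitesimalGenerator A S
  growth : ∀ τ : ℝ, 0 ≤ τ → ∀ x : StrongDual ℝ V, ‖S τ x‖ ≤ Real.exp (ω * τ) * ‖x‖
  g₀_mem : MemSigmaZero g₀
  h₀_convex : ConvexOn ℝ univ h₀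
  h₀_lsc : LowerSemicontinuous h₀
  /-- The multivalued map `∂h₀` is injective. -/
  h₀_subdiff_injective : ∀ u v φ : U, φ ∈ subdiff h₀ u → φ ∈ subdiff h₀ v → u = v
  /-- `h₀*` is finite everywhere. -/
  conj_finite : ∀ x : U, BddAbove (range fun y : U => ⟪x, y⟫ - h₀ y)
  conj_zero : conj h₀ 0 = 0
  conj_mem : MemSigmaZero (conj h₀)
  coercive : ∃ a : ℝ, 0 < a ∧ ∃ b : ℝ, ∀ u : U, a * ‖u‖ ^ p + b ≤ h₀ u
  one_lt_p : 1 < p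
  ω_lt : ω < lam

/-- `y` is the mild solution of `y' = A y + B u` on `[t, +∞)`, `y(t) = x`, where `S τ = e^{τA}`. -/
def IsMildState (S : ℝ → StrongDual ℝ V →L[ℝ] StrongDual ℝ V) (B : U →L[ℝ] StrongDual ℝ V)
    (t : ℝ) (x : StrongDual ℝ V) (u : ℝ → U) (y : ℝ → StrongDual ℝ V) : Prop :=
  LocallyIntegrableOn y (Ici t) ∧
    ∀ τ, t ≤ τ → y τ = S (τ - t) x + ∫ σ in t..τ, S (τ - σ) (B (u σ))

/-- The discounted running cost at time `τ`. -/
def runningCost (g₀ : StrongDual ℝ V → ℝ) (h₀ : U → ℝ) (lam : ℝ)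
    (u : ℝ → U) (y : ℝ → StrongDual ℝ V) (τ : ℝ) : ℝ :=
  Real.exp (-(lam * τ)) * (g₀ (y τ) + h₀ (u τ))

/-- The integral of the running cost over `[t, +∞)` has a meaning in `[-∞, +∞]`: its positive
part or its negative part has finite integral. -/
def CostDefined (g₀ : StrongDual ℝ V → ℝ) (h₀ : U → ℝ) (lam t : ℝ)
    (u : ℝ → U) (y : ℝ → StrongDual ℝ V) : Prop :=
  (∫⁻ τ in Ici t, ENNReal.ofReal (runningCost g₀ h₀ lam u y τ)) ≠ ⊤ ∨
    (∫⁻ τ in Ici t, ENNReal.ofReal (-runningCost g₀ h₀ lam u y τ)) ≠ ⊤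

/-- The cost `∫_t^∞ e^{-λτ} [g₀(y(τ)) + h₀(u(τ))] dτ` in `[-∞, +∞]`. -/
def cost (g₀ : StrongDual ℝ V → ℝ) (h₀ : U → ℝ) (lam t : ℝ)
    (u : ℝ → U) (y : ℝ → StrongDual ℝ V) : EReal :=
  ((∫⁻ τ in Ici t, ENNReal.ofReal (runningCost g₀ h₀ lam u y τ) : ℝ≥0∞) : EReal) -
    ((∫⁻ τ in Ici t, ENNReal.ofReal (-runningCost g₀ h₀ lam u y τ) : ℝ≥0∞) : EReal)

/-- `(u, y)` is an admissible pair at `(t, x)`: `u ∈ L^p_λ(t, +∞; U)`, `y` is the corresponding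
mild trajectory, and the cost has a meaning. (For `λ > 0` the last clause always holds, as the
negative part of the running cost is then integrable.) -/
structure IsAdmissible (S : ℝ → StrongDual ℝ V →L[ℝ] StrongDual ℝ V)
    (B : U →L[ℝ] StrongDual ℝ V) (g₀ : StrongDual ℝ V → ℝ) (h₀ : U → ℝ) (p lam t : ℝ)
    (x : StrongDual ℝ V) (u : ℝ → U) (y : ℝ → StrongDual ℝ V) : Prop where
  control : MemWeightedLp p lam t u
  state : IsMildState S B t x u y
  costDefined : CostDefined g₀ h₀ lam t u y

/-- `(u, y)` is an optimal pair at `(t, x)`: it is admissible and minimizes the cost among all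
admissible pairs at `(t, x)`. -/
def IsOptimal (S : ℝ → StrongDual ℝ V →L[ℝ] StrongDual ℝ V)
    (B : U →L[ℝ] StrongDual ℝ V) (g₀ : StrongDual ℝ V → ℝ) (h₀ : U → ℝ) (p lam t : ℝ)
    (x : StrongDual ℝ V) (u : ℝ → U) (y : ℝ → StrongDual ℝ V) : Prop :=
  IsAdmissible S B g₀ h₀ p lam t x u y ∧
    ∀ (v : ℝ → U) (z : ℝ → StrongDual ℝ V), IsAdmissible S B g₀ h₀ p lam t x v z →
      cost g₀ h₀ lam t u y ≤ cost g₀ h₀ lam t v z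

/-- `π` is the mild solution of `π' = (λ - A₁*) π - g₀'(y)` on `[t, +∞)` with the transversality
condition: `π(τ) = ∫_τ^∞ e^{(A₁* - λ)(σ - τ)} g₀'(y(σ)) dσ`, the integral being convergent.
Here `e^{τ A₁*}` is the adjoint of `S τ = e^{τA}` in the duality between `V'` and `V`. -/
def IsMildCostate (S : ℝ → StrongDual ℝ V →L[ℝ] StrongDual ℝ V) (g₀ : StrongDual ℝ V → ℝ)
    (lam t : ℝ) (y : ℝ → StrongDual ℝ V) (π : ℝ → V) : Prop :=
  ∀ τ, t ≤ τ →
    IntegrableOn (fun σ => Real.exp (-(lam * (σ - τ))) •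
      dualityAdjoint (S (σ - τ)) (dualGradient g₀ (y σ))) (Ioi τ) ∧
    π τ = ∫ σ in Ioi τ, Real.exp (-(lam * (σ - τ))) •
      dualityAdjoint (S (σ - τ)) (dualGradient g₀ (y σ))

/-- The optimality system for the triple `(u, y, π)` at `(t, x)`, in mild form. -/
structure SolvesOptimalitySystem (S : ℝ → StrongDual ℝ V →L[ℝ] StrongDual ℝ V)
    (B : U →L[ℝ] StrongDual ℝ V) (g₀ : StrongDual ℝ V → ℝ) (h₀ : U → ℝ) (ω lam t : ℝ)
    (x : StrongDual ℝ V) (u : ℝ → U) (y : ℝ → StrongDual ℝ V) (π : ℝ → V) : Prop where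
  state : IsMildState S B t x u y
  costate : IsMildCostate S g₀ lam t y π
  transversality : Tendsto (fun T : ℝ => Real.exp ((ω - lam) * T) • π T) atTop (𝓝 0)
  maximum : ∀ᵐ τ ∂(volume.restrict (Ici t)), -controlAdjoint B (π τ) ∈ subdiff h₀ (u τ)

end Problem

end BoundaryControl

end

/-! Both parts rest on one duality formula. If ζ(τ) = ∫_t^τ e^{(τ-σ)A} f(σ) dσ and π is the mild
costate, then Fubini over the triangle t < σ < τ ≤ T, together with the semigroup law applied to the
tail of π, gives ∫_t^T e^{-λτ} ⟨ζ, g₀'(y)⟩ dτ = ∫_t^T e^{-λσ} ⟨f, π⟩ dσ - e^{-λT} ⟨ζ(T), π(T)⟩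
(`IsMildCostate.duality`). It is used with f = B(v - u), for which ζ is the difference of the two
trajectories.

Sufficiency. The tangent inequality for `g₀` at y and the inclusion -B*π ∈ ∂h₀(u) bound the running
cost of (v, z) from below by that of (u, y) plus a term k (`runningCost_add_le`). By duality the
integral of k over (t, T] is minus the boundary term, so it remains to make that term vanish along
some sequence T → ∞ (`cost_le_of_boundary`). For λ > 0 the measure e^{-λτ}dτ is finite, everything
lies in the weighted L², and since 2ω < λ both factors, weighted by e^{-λT/2}, tend to zero. For λ ≤
0 one has ω < λ/p; the state factor decays with weight e^{-λT/p}, and membership of π in L^q_λ makes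
the other factor small along a sequence.

Necessity. For λ > 0 the costate is defined by its integral formula and lies in L²_λ, hence in
L^q_λ. Moving the optimal control to u + θ(v - u), and using convexity of `h₀` and a quadratic upper
bound for `g₀`, yields a nonnegative first variation (`integral_variation_nonneg`), which duality
rewrites as an integral of ⟨B(v - u), π⟩ + h₀(v) - h₀(u). Taking v constant on a measurable set and
equal to u elsewhere localises this to almost every time (`maximum_of_isOptimal`).

The norm estimates all reduce to convolution with e^{-c|s|}, c > 0, which maps L^r to L^r and to
functions vanishing at +∞. -/

noncomputable section

namespace BoundaryControl

/-! ### Convolution with a two-sided exponential kernel -/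

/-- Convolution of a nonnegative function with the kernel `e^{-c|s|}`. -/
def expConv (c : ℝ) (f : ℝ → ℝ≥0∞) (τ : ℝ) : ℝ≥0∞ :=
  ∫⁻ σ, ENNReal.ofReal (Real.exp (-(c * |τ - σ|))) * f σ

theorem measurable_expKernel (c : ℝ) :
    Measurable (fun z : ℝ × ℝ => ENNReal.ofReal (Real.exp (-(c * |z.1 - z.2|)))) := by
  refine ENNReal.measurable_ofReal.comp (Continuous.measurable ?_)
  fun_prop

theorem integrable_exp_neg_mul_abs {c : ℝ} (hc : 0 < c) :
    Integrable (fun s : ℝ => Real.exp (-(c * |s|))) := by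
  have h : IntegrableOn (fun s : ℝ => Real.exp (-(c * |s|))) (Ioi 0) := by
    refine (integrableOn_exp_mul_Ioi (a := -c) (by linarith) 0).congr_fun (fun s hs => ?_)
      measurableSet_Ioi
    simp [abs_of_pos (mem_Ioi.1 hs)]
  have h' : IntegrableOn (fun s : ℝ => Real.exp (-(c * |s|))) (Iic 0) := by
    refine (integrableOn_exp_mul_Iic hc 0).congr_fun (fun s hs => ?_) measurableSet_Iic
    simp [abs_of_nonpos (mem_Iic.1 hs)]
  rw [← integrableOn_univ, ← Iic_union_Ioi (a := (0 : ℝ))]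
  exact h'.union h

theorem lintegral_expKernel_ne_top {c : ℝ} (hc : 0 < c) :
    (∫⁻ s : ℝ, ENNReal.ofReal (Real.exp (-(c * |s|)))) ≠ ⊤ := by
  have := (integrable_exp_neg_mul_abs hc).lintegral_lt_top
  exact this.ne

theorem lintegral_expKernel_sub_left (c τ : ℝ) :
    (∫⁻ σ : ℝ, ENNReal.ofReal (Real.exp (-(c * |τ - σ|)))) =
      ∫⁻ s : ℝ, ENNReal.ofReal (Real.exp (-(c * |s|))) :=
  lintegral_sub_left_eq_self (fun s => ENNReal.ofReal (Real.exp (-(c * |s|)))) τ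

theorem lintegral_expKernel_sub_right (c σ : ℝ) :
    (∫⁻ τ : ℝ, ENNReal.ofReal (Real.exp (-(c * |τ - σ|)))) =
      ∫⁻ s : ℝ, ENNReal.ofReal (Real.exp (-(c * |s|))) :=
  lintegral_sub_right_eq_self (fun s => ENNReal.ofReal (Real.exp (-(c * |s|)))) σ

/-- Jensen's inequality in the form of Hölder on a finite measure: the kernel centred at τ is taken
as a density, so the convolution is an L¹ norm, compared with the L^r norm for the same density. -/
theorem rpow_expConv_le (c : ℝ) {r : ℝ} (hr : 1 ≤ r) {f : ℝ → ℝ≥0∞}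
    (hf : AEMeasurable f) (τ : ℝ) :
    expConv c f τ ^ r ≤ (∫⁻ s : ℝ, ENNReal.ofReal (Real.exp (-(c * |s|)))) ^ (r - 1) *
      expConv c (fun σ => f σ ^ r) τ := by
  set k : ℝ → ℝ≥0∞ := fun σ => ENNReal.ofReal (Real.exp (-(c * |τ - σ|))) with hk
  have hkm : Measurable k := (measurable_expKernel c).comp (measurable_const.prodMk measurable_id)
  have hr0 : 0 < r := by linarith
  have hac : volume.withDensity k ≪ volume := withDensity_absolutelyContinuous _ _
  have h := eLpNorm_le_eLpNorm_mul_rpow_measure_univ (μ := volume.withDensity k) (f := f)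
    (p := 1) (q := ENNReal.ofReal r) (by simpa using hr) (hf.mono_ac hac).aestronglyMeasurable
  rw [eLpNorm_one_eq_lintegral_enorm, eLpNorm_eq_lintegral_rpow_enorm_toReal (by simpa using hr0)
    ENNReal.ofReal_ne_top, ENNReal.toReal_ofReal hr0.le, withDensity_apply _ MeasurableSet.univ,
    Measure.restrict_univ] at h
  simp only [enorm_eq_self] at h
  rw [lintegral_withDensity_eq_lintegral_mul₀ hkm.aemeasurable hf,
    lintegral_withDensity_eq_lintegral_mul₀ hkm.aemeasurable (hf.pow_const r)] at h
  rw [← lintegral_expKernel_sub_left c τ]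
  calc expConv c f τ ^ r ≤ _ := ENNReal.rpow_le_rpow h hr0.le
    _ = _ := by
      rw [ENNReal.mul_rpow_of_nonneg _ _ hr0.le, ← ENNReal.rpow_mul, ← ENNReal.rpow_mul,
        one_div, inv_mul_cancel₀ hr0.ne', ENNReal.rpow_one, mul_comm]
      congr 2
      simp; field_simp

theorem expConv_ne_top {c : ℝ} (hc : 0 < c) {r : ℝ} (hr : 1 ≤ r) {f : ℝ → ℝ≥0∞}
    (hf : AEMeasurable f) (hfr : (∫⁻ σ, f σ ^ r) ≠ ⊤) (τ : ℝ) : expConv c f τ ≠ ⊤ := by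
  have h := rpow_expConv_le c hr hf τ
  intro htop
  rw [htop, ENNReal.top_rpow_of_pos (by linarith), top_le_iff] at h
  refine ENNReal.mul_ne_top (ENNReal.rpow_ne_top_of_nonneg (by linarith)
    (lintegral_expKernel_ne_top hc)) (ne_top_of_le_ne_top hfr (lintegral_mono fun σ => ?_)) h
  refine mul_le_of_le_one_left zero_le ?_
  rw [ENNReal.ofReal_le_one, Real.exp_le_one_iff]
  have := mul_nonneg hc.le (abs_nonneg (τ - σ))
  linarith

/-- Young's inequality L¹ * L^r ⊆ L^r: after the Jensen bound, Tonelli integrates the kernel in the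
other variable. -/
theorem lintegral_rpow_expConv_ne_top {c : ℝ} (hc : 0 < c) {r : ℝ} (hr : 1 ≤ r) {f : ℝ → ℝ≥0∞}
    (hf : AEMeasurable f) (hfr : (∫⁻ σ, f σ ^ r) ≠ ⊤) : (∫⁻ τ, expConv c f τ ^ r) ≠ ⊤ := by
  have hK := lintegral_expKernel_ne_top hc
  refine ne_top_of_le_ne_top ?_ (lintegral_mono fun τ => rpow_expConv_le c hr hf τ)
  rw [lintegral_const_mul' _ _ (ENNReal.rpow_ne_top_of_nonneg (by linarith) hK)]
  refine ENNReal.mul_ne_top (ENNReal.rpow_ne_top_of_nonneg (by linarith) hK) ?_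
  simp only [expConv]
  rw [lintegral_lintegral_swap]
  · have : ∀ σ, (∫⁻ τ, ENNReal.ofReal (Real.exp (-(c * |τ - σ|))) * f σ ^ r) =
        (∫⁻ s : ℝ, ENNReal.ofReal (Real.exp (-(c * |s|)))) * f σ ^ r := fun σ => by
      rw [lintegral_mul_const, lintegral_expKernel_sub_right]
      exact (measurable_expKernel c).comp (measurable_id.prodMk measurable_const)
    simp only [this]
    rw [lintegral_const_mul' _ _ hK]
    exact ENNReal.mul_ne_top hK hfr
  · exact (measurable_expKernel c).aemeasurable.mul (hf.pow_const r).comp_snd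

/-- Since the kernel is at most 1 and tends to 0 for fixed σ as τ → ∞, dominated convergence applies
to `f ^ r`, which is integrable although `f` need not be. The Jensen bound transfers the limit to
`f`. -/
theorem tendsto_expConv {c : ℝ} (hc : 0 < c) {r : ℝ} (hr : 1 ≤ r) {f : ℝ → ℝ≥0∞}
    (hf : AEMeasurable f) (hfr : (∫⁻ σ, f σ ^ r) ≠ ⊤) : Tendsto (expConv c f) atTop (𝓝 0) := by
  have hK := lintegral_expKernel_ne_top hc
  have hr0 : 0 < r := by linarith
  have h1 : Tendsto (expConv c (fun σ => f σ ^ r)) atTop (𝓝 0) := by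
    have h0 : (∫⁻ _ : ℝ, (0 : ℝ≥0∞)) = 0 := by simp
    rw [← h0]
    refine tendsto_lintegral_filter_of_dominated_convergence' (fun σ => f σ ^ r)
      (Eventually.of_forall fun τ => ?_) (Eventually.of_forall fun τ => ae_of_all _ fun σ => ?_)
      hfr ?_
    · exact (((measurable_expKernel c).comp
        (measurable_const.prodMk measurable_id)).aemeasurable).mul (hf.pow_const r)
    · refine mul_le_of_le_one_left zero_le ?_
      rw [ENNReal.ofReal_le_one, Real.exp_le_one_iff]
      have := mul_nonneg hc.le (abs_nonneg (τ - σ))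
      linarith
    · filter_upwards [ae_lt_top' (hf.pow_const r) hfr] with σ hσ
      rw [← zero_mul (f σ ^ r)]
      refine ENNReal.Tendsto.mul_const ?_ (Or.inr hσ.ne)
      rw [← ENNReal.ofReal_zero]
      refine ENNReal.tendsto_ofReal (Real.tendsto_exp_atBot.comp ?_)
      refine tendsto_neg_atTop_atBot.comp ((tendsto_abs_atTop_atTop.comp
        (tendsto_atTop_add_const_right _ (-σ) tendsto_id)).const_mul_atTop hc)
  have h2 : Tendsto (fun τ => expConv c f τ ^ r) atTop (𝓝 0) := by
    have h3 := ENNReal.Tendsto.const_mul (a := (∫⁻ s : ℝ, ENNReal.ofReal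
      (Real.exp (-(c * |s|)))) ^ (r - 1)) h1
      (Or.inr (ENNReal.rpow_ne_top_of_nonneg (by linarith) hK))
    rw [mul_zero] at h3
    exact tendsto_of_tendsto_of_tendsto_of_le_of_le tendsto_const_nhds h3 (fun _ => zero_le)
      (fun τ => rpow_expConv_le c hr hf τ)
  have h3 := (ENNReal.continuous_rpow_const (y := r⁻¹)).tendsto 0 |>.comp h2
  rw [ENNReal.zero_rpow_of_pos (by positivity)] at h3
  refine h3.congr fun τ => ?_
  simp only [Function.comp]
  rw [← ENNReal.rpow_mul, mul_inv_cancel₀ hr0.ne', ENNReal.rpow_one]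

/-! ### The discounted measure and weighted Lebesgue spaces -/

/-- The measure `e^{-λτ} dτ` on `[t, +∞)`. -/
def discount (lam t : ℝ) : Measure ℝ :=
  (volume.restrict (Ici t)).withDensity fun τ => ENNReal.ofReal (Real.exp (-(lam * τ)))

theorem measurable_discount_density (lam : ℝ) :
    Measurable fun τ : ℝ => ENNReal.ofReal (Real.exp (-(lam * τ))) :=
  ENNReal.measurable_ofReal.comp (Continuous.measurable (by fun_prop))

theorem discount_absolutelyContinuous (lam t : ℝ) : discount lam t ≪ volume.restrict (Ici t) :=
  withDensity_absolutelyContinuous _ _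

theorem absolutelyContinuous_discount (lam t : ℝ) : volume.restrict (Ici t) ≪ discount lam t :=
  withDensity_absolutelyContinuous' (measurable_discount_density lam).aemeasurable
    (ae_of_all _ fun τ => by simpa using Real.exp_pos _)

theorem aestronglyMeasurable_discount {F : Type*} [TopologicalSpace F] {lam t : ℝ} {f : ℝ → F} :
    AEStronglyMeasurable f (discount lam t) ↔
      AEStronglyMeasurable f (volume.restrict (Ici t)) :=
  ⟨fun h => h.mono_ac (absolutelyContinuous_discount lam t),
    fun h => h.mono_ac (discount_absolutelyContinuous lam t)⟩

theorem ae_discount {lam t : ℝ} {P : ℝ → Prop} :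
    (∀ᵐ τ ∂discount lam t, P τ) ↔ ∀ᵐ τ ∂volume.restrict (Ici t), P τ :=
  ⟨fun h => (absolutelyContinuous_discount lam t).ae_le h,
    fun h => (discount_absolutelyContinuous lam t).ae_le h⟩

theorem integrable_discount {F : Type*} [NormedAddCommGroup F] [NormedSpace ℝ F] {lam t : ℝ}
    {f : ℝ → F} : Integrable f (discount lam t) ↔
      IntegrableOn (fun τ => Real.exp (-(lam * τ)) • f τ) (Ici t) := by
  rw [discount, integrable_withDensity_iff_integrable_smul' (measurable_discount_density lam)
    (ae_of_all _ fun τ => ENNReal.ofReal_lt_top)]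
  simp only [ENNReal.toReal_ofReal (Real.exp_pos _).le]
  rfl

theorem integral_discount {F : Type*} [NormedAddCommGroup F] [NormedSpace ℝ F] {lam t : ℝ}
    {f : ℝ → F} : ∫ τ, f τ ∂discount lam t = ∫ τ in Ici t, Real.exp (-(lam * τ)) • f τ := by
  rw [discount, integral_withDensity_eq_integral_toReal_smul (measurable_discount_density lam)
    (ae_of_all _ fun τ => ENNReal.ofReal_lt_top)]
  simp only [ENNReal.toReal_ofReal (Real.exp_pos _).le]

theorem aestronglyMeasurable_exp_smul {F : Type*} [NormedAddCommGroup F] [NormedSpace ℝ F]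
    {μ : Measure ℝ} {φ : ℝ → ℝ} (hφ : Continuous φ) {f : ℝ → F} :
    AEStronglyMeasurable (fun τ => Real.exp (φ τ) • f τ) μ ↔ AEStronglyMeasurable f μ := by
  refine ⟨fun h => ?_, fun h =>
    (Real.continuous_exp.comp hφ).aestronglyMeasurable.smul h⟩
  have h' : AEStronglyMeasurable (fun τ => Real.exp (-φ τ) • Real.exp (φ τ) • f τ) μ :=
    (Real.continuous_exp.comp hφ.neg).aestronglyMeasurable.smul h
  refine h'.congr (ae_of_all _ fun τ => ?_)
  simp only [smul_smul, ← Real.exp_add, neg_add_cancel, Real.exp_zero, one_smul]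

/-- The r-th power of the weight e^{-λτ/r} is e^{-λτ}, so for every exponent the weighted space is
an ordinary Lebesgue space over one and the same measure. When λ > 0 this measure is finite and the
spaces are nested. -/
theorem memWeightedLp_iff {F : Type*} [NormedAddCommGroup F] [NormedSpace ℝ F] {r lam t : ℝ}
    (hr : 0 < r) {f : ℝ → F} :
    MemWeightedLp r lam t f ↔ MemLp f (ENNReal.ofReal r) (discount lam t) := by
  have hr' : ENNReal.ofReal r ≠ 0 := by simpa using hr
  refine and_congr ?_ ?_
  · rw [aestronglyMeasurable_discount, aestronglyMeasurable_exp_smul (by fun_prop)]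
  · rw [eLpNorm_lt_top_iff_lintegral_rpow_enorm_lt_top hr' ENNReal.ofReal_ne_top,
      eLpNorm_lt_top_iff_lintegral_rpow_enorm_lt_top hr' ENNReal.ofReal_ne_top,
      ENNReal.toReal_ofReal hr.le, discount,
      lintegral_withDensity_eq_lintegral_mul_non_measurable _ (measurable_discount_density lam)
        (ae_of_all _ fun τ => ENNReal.ofReal_lt_top)]
    simp only [Pi.mul_apply]
    refine iff_of_eq (congrArg (· < ⊤) (lintegral_congr fun τ => ?_))
    rw [enorm_smul, ENNReal.mul_rpow_of_nonneg _ _ hr.le, Real.enorm_eq_ofReal (Real.exp_pos _).le,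
      ENNReal.ofReal_rpow_of_pos (Real.exp_pos _), ← Real.exp_mul]
    congr 4
    field_simp

theorem isFiniteMeasure_discount {lam : ℝ} (hlam : 0 < lam) (t : ℝ) :
    IsFiniteMeasure (discount lam t) := by
  have h : Integrable (fun _ : ℝ => (1 : ℝ)) (discount lam t) := by
    rw [integrable_discount, integrableOn_Ici_iff_integrableOn_Ioi]
    simpa using integrableOn_exp_mul_Ioi (neg_neg_of_pos hlam) t
  simpa [integrable_const_iff] using h

/-! ### Convolution with the semigroup -/

section Duhamel

variable {X : Type*} [NormedAddCommGroup X] [NormedSpace ℝ X]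

/-- The convolution `∫_t^τ S(τ - σ) f(σ) dσ`. -/
def duhamel (S : ℝ → X →L[ℝ] X) (t : ℝ) (f : ℝ → X) (τ : ℝ) : X :=
  ∫ σ in t..τ, S (τ - σ) (f σ)

variable {S : ℝ → X →L[ℝ] X} {ω : ℝ}

/-- Strong continuity and the locally uniform bound e^{ωτ} give joint continuity. Time is clamped at
0 because `S` is arbitrary at negative times; every measurability statement about the semigroup goes
through this form. -/
theorem IsC0Semigroup.continuous_max (hS : IsC0Semigroup S)
    (hg : ∀ τ : ℝ, 0 ≤ τ → ∀ x : X, ‖S τ x‖ ≤ Real.exp (ω * τ) * ‖x‖) :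
    Continuous fun z : ℝ × X => S (max z.1 0) z.2 := by
  rw [continuous_iff_continuousAt]
  rintro ⟨s, x⟩
  have h1 : Continuous fun r : ℝ => S (max r 0) x :=
    (hS.continuousOn x).comp_continuous (by fun_prop) fun r => le_max_right r 0
  have h2 : Tendsto (fun z : ℝ × X => Real.exp (ω * max z.1 0) * ‖z.2 - x‖ +
      ‖S (max z.1 0) x - S (max s 0) x‖) (𝓝 (s, x)) (𝓝 0) := by
    have h3 : Continuous fun z : ℝ × X => Real.exp (ω * max z.1 0) * ‖z.2 - x‖ +
      ‖S (max z.1 0) x - S (max s 0) x‖ := by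
      have h4 : Continuous fun z : ℝ × X => S (max z.1 0) x := h1.comp continuous_fst
      exact Continuous.add (by fun_prop) (h4.sub continuous_const).norm
    simpa using h3.tendsto (s, x)
  rw [ContinuousAt, tendsto_iff_norm_sub_tendsto_zero]
  refine squeeze_zero (fun _ => norm_nonneg _) (fun z => ?_) h2
  calc ‖S (max z.1 0) z.2 - S (max s 0) x‖
      = ‖S (max z.1 0) (z.2 - x) + (S (max z.1 0) x - S (max s 0) x)‖ := by
        rw [map_sub]; congr 1; abel
    _ ≤ _ := (norm_add_le _ _).trans (by gcongr; exact hg _ (le_max_right _ _) _)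

theorem IsC0Semigroup.aestronglyMeasurable_comp (hS : IsC0Semigroup S)
    (hg : ∀ τ : ℝ, 0 ≤ τ → ∀ x : X, ‖S τ x‖ ≤ Real.exp (ω * τ) * ‖x‖)
    {α : Type*} [MeasurableSpace α] {μ : Measure α} {s : α → ℝ} {f : α → X}
    (hs : AEStronglyMeasurable s μ) (hf : AEStronglyMeasurable f μ) :
    AEStronglyMeasurable (fun a => S (max (s a) 0) (f a)) μ :=
  (hS.continuous_max hg).comp_aestronglyMeasurable (hs.prodMk hf)

theorem duhamel_eq_setIntegral {t τ : ℝ} (hτ : t ≤ τ) (f : ℝ → X) :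
    duhamel S t f τ = ∫ σ in Ioc t τ, S (max (τ - σ) 0) (f σ) := by
  rw [duhamel, intervalIntegral.integral_of_le hτ]
  refine setIntegral_congr_fun measurableSet_Ioc fun σ hσ => ?_
  simp only [max_eq_left (sub_nonneg.2 hσ.2)]

theorem IsC0Semigroup.integrableOn_comp (hS : IsC0Semigroup S)
    (hg : ∀ τ : ℝ, 0 ≤ τ → ∀ x : X, ‖S τ x‖ ≤ Real.exp (ω * τ) * ‖x‖)
    {t τ : ℝ} {f : ℝ → X} (hf : IntegrableOn f (Ioc t τ)) :
    IntegrableOn (fun σ => S (max (τ - σ) 0) (f σ)) (Ioc t τ) := by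
  refine Integrable.mono' (hf.norm.const_mul (Real.exp (|ω| * (τ - t))))
    (hS.aestronglyMeasurable_comp hg (Continuous.aestronglyMeasurable (by fun_prop))
      hf.aestronglyMeasurable) ?_
  refine (ae_restrict_iff' measurableSet_Ioc).2 (ae_of_all _ fun σ hσ => ?_)
  have h1 := sub_nonneg.2 hσ.2
  rw [max_eq_left h1]
  refine (hg _ h1 _).trans ?_
  gcongr
  · exact le_abs_self ω
  · exact hσ.1.le

theorem norm_duhamel_le
    (hg : ∀ τ : ℝ, 0 ≤ τ → ∀ x : X, ‖S τ x‖ ≤ Real.exp (ω * τ) * ‖x‖)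
    {t τ T : ℝ} (hτ : t ≤ τ) (hT : τ ≤ T) {f : ℝ → X} (hf : IntegrableOn f (Ioc t T)) :
    ‖duhamel S t f τ‖ ≤ Real.exp (|ω| * (T - t)) * ∫ σ in Ioc t T, ‖f σ‖ := by
  have hf' : IntegrableOn (fun σ => Real.exp (|ω| * (T - t)) * ‖f σ‖) (Ioc t T) :=
    hf.norm.const_mul _
  rw [duhamel, intervalIntegral.integral_of_le hτ, ← integral_const_mul]
  refine (norm_integral_le_of_norm_le (hf'.mono_set (Ioc_subset_Ioc_right hT))
    ((ae_restrict_iff' measurableSet_Ioc).2 (ae_of_all _ fun σ hσ => ?_))).trans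
    (setIntegral_mono_set hf' (ae_of_all _ fun σ => by positivity)
      (Ioc_subset_Ioc_right hT).eventuallyLE)
  refine (hg _ (sub_nonneg.2 hσ.2) _).trans ?_
  gcongr
  · exact sub_nonneg.2 hσ.2
  · exact le_abs_self ω
  · exact hσ.1.le

/-- Extending the integrand by zero off the triangle σ ≤ τ turns the variable upper limit into a
fixed domain, so measurability of partial integrals on a product applies. -/
theorem IsC0Semigroup.aestronglyMeasurable_duhamel (hS : IsC0Semigroup S)
    (hg : ∀ τ : ℝ, 0 ≤ τ → ∀ x : X, ‖S τ x‖ ≤ Real.exp (ω * τ) * ‖x‖)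
    {t : ℝ} {f : ℝ → X} (hf : AEStronglyMeasurable f (volume.restrict (Ici t))) :
    AEStronglyMeasurable (duhamel S t f) (volume.restrict (Ici t)) := by
  have hset : MeasurableSet {z : ℝ × ℝ | z.2 ≤ z.1} := measurableSet_le measurable_snd measurable_fst
  have h1 : AEStronglyMeasurable ({z : ℝ × ℝ | z.2 ≤ z.1}.indicator fun z =>
      S (max (z.1 - z.2) 0) (f z.2)) ((volume.restrict (Ici t)).prod (volume.restrict (Ici t))) :=
    (hS.aestronglyMeasurable_comp hg (Continuous.aestronglyMeasurable (by fun_prop))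
      hf.comp_snd).indicator hset
  refine h1.integral_prod_right'.congr
    ((ae_restrict_iff' measurableSet_Ici).2 (ae_of_all _ fun τ hτ => ?_))
  rw [duhamel_eq_setIntegral hτ, ← integral_Icc_eq_integral_Ioc]
  have h2 : ∀ σ, {z : ℝ × ℝ | z.2 ≤ z.1}.indicator (fun z => S (max (z.1 - z.2) 0) (f z.2)) (τ, σ) =
      (Iic τ).indicator (fun σ => S (max (τ - σ) 0) (f σ)) σ := fun σ => by
    simp [indicator_apply]
  simp only [h2]
  rw [setIntegral_indicator measurableSet_Iic, Ici_inter_Iic]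

/-- The identity e^{-κτ} e^{ω(τ-σ)} = e^{-(κ-ω)(τ-σ)} e^{-κσ} distributes the weight between kernel
and input; the rate κ - ω has to be positive for the bound to be useful. -/
theorem enorm_exp_smul_duhamel_le
    (hg : ∀ τ : ℝ, 0 ≤ τ → ∀ x : X, ‖S τ x‖ ≤ Real.exp (ω * τ) * ‖x‖)
    (κ : ℝ) {t τ : ℝ} (hτ : t ≤ τ) (f : ℝ → X) :
    ‖Real.exp (-(κ * τ)) • duhamel S t f τ‖ₑ ≤
      expConv (κ - ω) ((Ici t).indicator fun σ => ‖Real.exp (-(κ * σ)) • f σ‖ₑ) τ := by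
  rw [duhamel, intervalIntegral.integral_of_le hτ, ← integral_smul]
  refine (enorm_integral_le_lintegral_enorm _).trans ?_
  rw [expConv, ← lintegral_indicator measurableSet_Ioc]
  refine lintegral_mono fun σ => ?_
  refine indicator_apply_le' (fun hσ => ?_) (fun _ => zero_le)
  have h1 := sub_nonneg.2 hσ.2
  rw [indicator_of_mem (show σ ∈ Ici t from hσ.1.le), abs_of_nonneg h1,
    ← Real.enorm_eq_ofReal (Real.exp_pos _).le, ← enorm_norm (Real.exp (-(κ * σ)) • f σ),
    ← enorm_mul, enorm_le_iff_norm_le]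
  rw [norm_smul, norm_mul, norm_norm, norm_smul]
  simp only [Real.norm_eq_abs, Real.abs_exp]
  calc Real.exp (-(κ * τ)) * ‖S (τ - σ) (f σ)‖
      ≤ Real.exp (-(κ * τ)) * (Real.exp (ω * (τ - σ)) * ‖f σ‖) := by gcongr; exact hg _ h1 _
    _ = _ := by
      rw [← mul_assoc, ← mul_assoc, ← Real.exp_add, ← Real.exp_add]
      congr 2; ring

/-- The weighted norm `‖e^{-λσ/r} f(σ)‖`, extended by zero outside `[t, +∞)`. -/
def weightedNorm (r lam t : ℝ) (f : ℝ → X) : ℝ → ℝ≥0∞ :=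
  (Ici t).indicator fun σ => ‖Real.exp (-(lam * σ / r)) • f σ‖ₑ

theorem MemWeightedLp.aemeasurable_weightedNorm {r lam t : ℝ} {f : ℝ → X}
    (hf : MemWeightedLp r lam t f) : AEMeasurable (weightedNorm r lam t f) :=
  (aemeasurable_indicator_iff measurableSet_Ici).2 hf.1.enorm

theorem MemWeightedLp.lintegral_weightedNorm_ne_top {r lam t : ℝ} (hr : 0 < r) {f : ℝ → X}
    (hf : MemWeightedLp r lam t f) : (∫⁻ σ, weightedNorm r lam t f σ ^ r) ≠ ⊤ := by
  have h := (eLpNorm_lt_top_iff_lintegral_rpow_enorm_lt_top (by simpa using hr)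
    ENNReal.ofReal_ne_top).1 hf.2
  rw [ENNReal.toReal_ofReal hr.le, ← lintegral_indicator measurableSet_Ici] at h
  refine ne_of_eq_of_ne (lintegral_congr fun σ => ?_) h.ne
  by_cases hσ : σ ∈ Ici t
  · simp [weightedNorm, hσ]
  · simp [weightedNorm, hσ, hr]

theorem memWeightedLp_of_le_expConv {Y : Type*} [NormedAddCommGroup Y] [NormedSpace ℝ Y]
    {r lam t c : ℝ} (hr : 1 ≤ r) (hc : 0 < c) {f : ℝ → X}
    (hf : MemWeightedLp r lam t f) {F : ℝ → Y}
    (hF : AEStronglyMeasurable F (volume.restrict (Ici t)))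
    (h : ∀ τ, t ≤ τ → ‖Real.exp (-(lam * τ / r)) • F τ‖ₑ ≤ expConv c (weightedNorm r lam t f) τ) :
    MemWeightedLp r lam t F := by
  have hr0 : 0 < r := by linarith
  refine ⟨(aestronglyMeasurable_exp_smul (by fun_prop)).2 hF, ?_⟩
  rw [eLpNorm_lt_top_iff_lintegral_rpow_enorm_lt_top (by simpa using hr0) ENNReal.ofReal_ne_top,
    ENNReal.toReal_ofReal hr0.le]
  refine lt_of_le_of_lt ?_ (lt_top_iff_ne_top.2 (lintegral_rpow_expConv_ne_top hc hr
    hf.aemeasurable_weightedNorm (hf.lintegral_weightedNorm_ne_top hr0)))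
  exact (setLIntegral_mono' measurableSet_Ici fun τ hτ =>
    ENNReal.rpow_le_rpow (h τ hτ) hr0.le).trans (setLIntegral_le_lintegral _ _)

theorem tendsto_of_le_expConv {Y : Type*} [NormedAddCommGroup Y] [NormedSpace ℝ Y]
    {r lam t c : ℝ} (hr : 1 ≤ r) (hc : 0 < c) {f : ℝ → X}
    (hf : MemWeightedLp r lam t f) {F : ℝ → Y}
    (h : ∀ τ, t ≤ τ → ‖Real.exp (-(lam * τ / r)) • F τ‖ₑ ≤ expConv c (weightedNorm r lam t f) τ) :
    Tendsto (fun τ => Real.exp (-(lam * τ / r)) • F τ) atTop (𝓝 0) := by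
  rw [tendsto_zero_iff_enorm_tendsto_zero]
  refine tendsto_of_tendsto_of_tendsto_of_le_of_le' tendsto_const_nhds
    (tendsto_expConv hc hr hf.aemeasurable_weightedNorm
      (hf.lintegral_weightedNorm_ne_top (by linarith)))
    (Eventually.of_forall fun _ => zero_le) ?_
  filter_upwards [eventually_ge_atTop t] with τ hτ using h τ hτ

theorem enorm_exp_smul_duhamel_le_weightedNorm
    (hg : ∀ τ : ℝ, 0 ≤ τ → ∀ x : X, ‖S τ x‖ ≤ Real.exp (ω * τ) * ‖x‖)
    (r lam : ℝ) {t τ : ℝ} (hτ : t ≤ τ) (f : ℝ → X) :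
    ‖Real.exp (-(lam * τ / r)) • duhamel S t f τ‖ₑ ≤
      expConv (lam / r - ω) (weightedNorm r lam t f) τ := by
  have h := enorm_exp_smul_duhamel_le hg (lam / r) hτ f
  simpa only [weightedNorm, div_mul_eq_mul_div] using h

theorem IsC0Semigroup.memWeightedLp_duhamel (hS : IsC0Semigroup S)
    (hg : ∀ τ : ℝ, 0 ≤ τ → ∀ x : X, ‖S τ x‖ ≤ Real.exp (ω * τ) * ‖x‖)
    {r lam t : ℝ} (hr : 1 ≤ r) (hω : ω < lam / r) {f : ℝ → X} (hf : MemWeightedLp r lam t f) :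
    MemWeightedLp r lam t (duhamel S t f) :=
  memWeightedLp_of_le_expConv hr (sub_pos.2 hω) hf
    (hS.aestronglyMeasurable_duhamel hg
      ((aestronglyMeasurable_exp_smul (by fun_prop)).1 hf.1))
    fun _ hτ => enorm_exp_smul_duhamel_le_weightedNorm hg r lam hτ f

theorem tendsto_exp_smul_duhamel
    (hg : ∀ τ : ℝ, 0 ≤ τ → ∀ x : X, ‖S τ x‖ ≤ Real.exp (ω * τ) * ‖x‖)
    {r lam t : ℝ} (hr : 1 ≤ r) (hω : ω < lam / r) {f : ℝ → X} (hf : MemWeightedLp r lam t f) :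
    Tendsto (fun τ => Real.exp (-(lam * τ / r)) • duhamel S t f τ) atTop (𝓝 0) :=
  tendsto_of_le_expConv hr (sub_pos.2 hω) hf
    fun _ hτ => enorm_exp_smul_duhamel_le_weightedNorm hg r lam hτ f

theorem MemWeightedLp.integrableOn_Icc {r lam t : ℝ} (hr : 1 ≤ r) {f : ℝ → X}
    (hf : MemWeightedLp r lam t f) (T : ℝ) : IntegrableOn f (Icc t T) := by
  have h1 : MemLp (fun τ => Real.exp (-(lam * τ / r)) • f τ) (ENNReal.ofReal r)
      (volume.restrict (Icc t T)) :=
    hf.mono_measure (Measure.restrict_mono Icc_subset_Ici_self le_rfl)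
  have h2 : IntegrableOn (fun τ => Real.exp (-(lam * τ / r)) • f τ) (Icc t T) :=
    h1.integrable (by simpa using hr)
  have h3 := h2.continuousOn_smul (f := fun τ => Real.exp (lam * τ / r)) (by fun_prop) isCompact_Icc
  refine h3.congr (ae_of_all _ fun τ => ?_)
  simp only [smul_smul, ← Real.exp_add, add_neg_cancel, Real.exp_zero, one_smul]

theorem MemWeightedLp.add {r lam t : ℝ} {f g : ℝ → X}
    (hf : MemWeightedLp r lam t f) (hg : MemWeightedLp r lam t g) :
    MemWeightedLp r lam t (fun τ => f τ + g τ) := by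
  refine (MemLp.add hf hg).ae_eq (ae_of_all _ fun τ => ?_)
  simp only [Pi.add_apply, smul_add]

theorem MemWeightedLp.sub {r lam t : ℝ} {f g : ℝ → X}
    (hf : MemWeightedLp r lam t f) (hg : MemWeightedLp r lam t g) :
    MemWeightedLp r lam t (fun τ => f τ - g τ) := by
  refine (MemLp.sub hf hg).ae_eq (ae_of_all _ fun τ => ?_)
  simp only [Pi.sub_apply, smul_sub]

theorem MemWeightedLp.const_smul {r lam t : ℝ} {f : ℝ → X}
    (hf : MemWeightedLp r lam t f) (c : ℝ) : MemWeightedLp r lam t (fun τ => c • f τ) := by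
  have h := MemLp.const_smul hf c
  refine h.ae_eq (ae_of_all _ fun τ => ?_)
  simp only [Pi.smul_apply, smul_comm c]

theorem MemWeightedLp.comp_clm {Y : Type*} [NormedAddCommGroup Y] [NormedSpace ℝ Y]
    {r lam t : ℝ} {f : ℝ → X} (hf : MemWeightedLp r lam t f) (L : X →L[ℝ] Y) :
    MemWeightedLp r lam t (fun τ => L (f τ)) := by
  have h := L.comp_memLp' hf
  refine h.ae_eq (ae_of_all _ fun τ => ?_)
  simp

/-- For λ > 0 the discounted measure is finite. This is where p ≥ 2 will bring controls into the
weighted L². -/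
theorem MemWeightedLp.mono_exponent {r s lam t : ℝ} (hlam : 0 < lam) (hs : 0 < s) (hsr : s ≤ r)
    {f : ℝ → X} (hf : MemWeightedLp r lam t f) : MemWeightedLp s lam t f := by
  have := isFiniteMeasure_discount hlam t
  rw [memWeightedLp_iff (by linarith)] at hf ⊢
  exact MemLp.mono_exponent hf (ENNReal.ofReal_le_ofReal hsr)

theorem memWeightedLp_const {r lam t : ℝ} (hlam : 0 < lam) (hr : 0 < r) (c : X) :
    MemWeightedLp r lam t fun _ => c := by
  have := isFiniteMeasure_discount hlam t
  rw [memWeightedLp_iff hr]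
  exact memLp_const c

end Duhamel

/-! ### Hilbert space duality and weak measurability -/

theorem countable_of_orthonormal {V : Type*} [NormedAddCommGroup V] [InnerProductSpace ℝ V]
    [TopologicalSpace.SeparableSpace V] {ι : Type*}
    {b : ι → V}
    (hb : Orthonormal ℝ b) : Countable ι := by
  refine Pairwise.countable_of_isOpen_disjoint (s := fun i => Metric.ball (b i) (1 / 2))
    (fun i j hij => Metric.ball_disjoint_ball ?_) (fun i => Metric.isOpen_ball)
    fun i => Metric.nonempty_ball.2 (by norm_num)
  have h := norm_sub_sq_real (b i) (b j)
  rw [hb.1 i, hb.1 j, hb.2 hij] at h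
  rw [dist_eq_norm]
  nlinarith [norm_nonneg (b i - b j)]

section Bidual

variable {V : Type*} [NormedAddCommGroup V] [InnerProductSpace ℝ V] [CompleteSpace V]

theorem norm_le_of_forall_dual {v : V} {C : ℝ} (hC : 0 ≤ C)
    (h : ∀ φ : StrongDual ℝ V, |φ v| ≤ C * ‖φ‖) : ‖v‖ ≤ C := by
  have h1 := h (InnerProductSpace.toDual ℝ V v)
  rw [InnerProductSpace.toDual_apply_apply, real_inner_self_eq_norm_sq, LinearIsometryEquiv.norm_map,
    abs_of_nonneg (by positivity), sq] at h1
  rcases (norm_nonneg v).eq_or_lt with h0 | h0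
  · rwa [← h0]
  · exact le_of_mul_le_mul_right h1 h0

theorem lipschitzWith_ofBidual : LipschitzWith 1 (ofBidual : StrongDual ℝ (StrongDual ℝ V) → V) := by
  refine LipschitzWith.of_dist_le_mul fun F G => ?_
  rw [NNReal.coe_one, one_mul, dist_eq_norm, dist_eq_norm]
  refine norm_le_of_forall_dual (norm_nonneg (F - G)) fun φ => ?_
  rw [map_sub, apply_ofBidual, apply_ofBidual]
  exact (F - G).le_opNorm φ

theorem norm_dualityAdjoint_le {T : StrongDual ℝ V →L[ℝ] StrongDual ℝ V} {C : ℝ} (hC : 0 ≤ C)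
    (hT : ∀ φ, ‖T φ‖ ≤ C * ‖φ‖) (v : V) : ‖dualityAdjoint T v‖ ≤ C * ‖v‖ := by
  refine norm_le_of_forall_dual (by positivity) fun φ => ?_
  rw [apply_dualityAdjoint, ← Real.norm_eq_abs, mul_right_comm]
  exact ((T φ).le_opNorm v).trans (by gcongr; exact hT φ)

/-- A Pettis-type criterion: in a separable Hilbert space the function is the limit of finite
partial sums of its expansion in a countable orthonormal basis. It serves the costate, where adjoint
operators become tractable only after pairing with a functional. -/
theorem aestronglyMeasurable_of_forall_dual [TopologicalSpace.SeparableSpace V] {α : Type*}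
    [MeasurableSpace α] {μ : Measure α} {f : α → V}
    (h : ∀ φ : StrongDual ℝ V, AEStronglyMeasurable (fun a => φ (f a)) μ) :
    AEStronglyMeasurable f μ := by
  obtain ⟨w, b, hb⟩ := exists_hilbertBasis ℝ V
  have hw : Countable w := countable_of_orthonormal b.orthonormal
  refine aestronglyMeasurable_of_tendsto_ae atTop
    (f := fun (s : Finset w) a => ∑ i ∈ s, b.repr (f a) i • b i) (fun s => ?_)
    (ae_of_all _ fun a => b.hasSum_repr (f a))
  refine Finset.aestronglyMeasurable_fun_sum _ fun i _ => ?_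
  simp only [b.repr_apply_apply]
  exact (h (InnerProductSpace.toDual ℝ V (b i))).smul aestronglyMeasurable_const

end Bidual

/-! ### Convex functions with Lipschitz derivative -/

section Convex

variable {X : Type*} [NormedAddCommGroup X] [NormedSpace ℝ X]

theorem fderiv_le_sub_of_convexOn {w : X → ℝ} (hc : ConvexOn ℝ univ w) (hd : Differentiable ℝ w)
    (x z : X) : fderiv ℝ w x (z - x) ≤ w z - w x := by
  have h1 : ConvexOn ℝ univ (fun s : ℝ => w (AffineMap.lineMap x z s)) := by
    have := hc.comp_affineMap (AffineMap.lineMap (k := ℝ) x z)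
    rwa [preimage_univ] at this
  have h2 : HasDerivAt (fun s : ℝ => w (AffineMap.lineMap x z s)) (fderiv ℝ w x (z - x)) 0 := by
    have h3 : HasFDerivAt w (fderiv ℝ w x) (AffineMap.lineMap x z (0 : ℝ)) := by
      simpa using (hd x).hasFDerivAt
    exact h3.comp_hasDerivAt 0 AffineMap.hasDerivAt_lineMap
  simpa [slope] using h1.le_slope_of_hasDerivAt (mem_univ 0) (mem_univ 1) one_pos h2

/-- The tangent inequality is taken at `z` instead of `x`, and the change of derivative between the
two points costs K‖z - x‖. The sharp constant K/2 is not needed. -/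
theorem MemSigmaZero.sub_le {w : X → ℝ} (hw : MemSigmaZero w) :
    ∃ K : ℝ, 0 ≤ K ∧ ∀ x z, w z - w x ≤ fderiv ℝ w x (z - x) + K * ‖z - x‖ ^ 2 := by
  obtain ⟨hc, hd, K, hK⟩ := hw
  refine ⟨K, K.2, fun x z => ?_⟩
  have h1 := fderiv_le_sub_of_convexOn hc hd z x
  have h2 : ‖fderiv ℝ w z - fderiv ℝ w x‖ ≤ K * ‖z - x‖ := by
    simpa [dist_eq_norm] using hK.dist_le_mul z x
  have h3 : (fderiv ℝ w z - fderiv ℝ w x) (z - x) ≤ K * ‖z - x‖ * ‖z - x‖ :=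
    (le_abs_self _).trans (((fderiv ℝ w z - fderiv ℝ w x).le_opNorm _).trans (by gcongr))
  rw [← neg_sub z x, map_neg] at h1
  rw [sub_apply] at h3
  linarith

theorem MemSigmaZero.abs_le_quadratic {w : X → ℝ} (hw : MemSigmaZero w) :
    ∃ C : ℝ, 0 ≤ C ∧ ∀ x, |w x| ≤ C * (1 + ‖x‖ ^ 2) := by
  obtain ⟨K, hK0, hK⟩ := hw.sub_le
  refine ⟨|w 0| + ‖fderiv ℝ w 0‖ + K, by positivity, fun x => ?_⟩
  have h1 := fderiv_le_sub_of_convexOn hw.1 hw.2.1 0 x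
  have h2 := hK 0 x
  have h3 := abs_le.1 ((fderiv ℝ w 0).le_opNorm x)
  simp only [sub_zero] at h1 h2
  have h4 := abs_le.1 (le_refl |w 0|)
  have h5 : ‖fderiv ℝ w 0‖ * ‖x‖ ≤ ‖fderiv ℝ w 0‖ * (1 + ‖x‖ ^ 2) := by
    gcongr; nlinarith [sq_nonneg (‖x‖ - 1)]
  have h6 : 0 ≤ |w 0| * ‖x‖ ^ 2 := by positivity
  have h7 : 0 ≤ K * ‖x‖ ^ 2 := by positivity
  rw [abs_le]
  constructor <;> nlinarith

/-- Closed sublevel sets at integer heights cover the space, so by Baire one has interior; a convex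
function bounded above near one point is continuous. -/
theorem continuous_of_convexOn_of_lowerSemicontinuous [CompleteSpace X] {h : X → ℝ}
    (hc : ConvexOn ℝ univ h) (hl : LowerSemicontinuous h) : Continuous h := by
  have h1 : ∃ n : ℕ, (interior {x | h x ≤ n}).Nonempty := by
    refine nonempty_interior_of_iUnion_of_closed (fun n => hl.isClosed_preimage _) ?_
    exact eq_univ_of_forall fun x => mem_iUnion.2 (exists_nat_ge (h x))
  obtain ⟨n, x₀, hx₀⟩ := h1
  rw [← continuousOn_univ]
  have h2 : IsBoundedUnder (· ≤ ·) (𝓝 x₀) h :=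
    ⟨n, eventually_map.2 (mem_interior_iff_mem_nhds.1 hx₀)⟩
  have h3 : ContinuousOn h univ ↔ ∃ x ∈ (univ : Set X), IsBoundedUnder (· ≤ ·) (𝓝 x) h :=
    (ConvexOn.continuousOn_tfae isOpen_univ univ_nonempty hc).out 1 3
  exact h3.2 ⟨x₀, mem_univ _, h2⟩

end Convex

section Gradient

variable {V : Type*} [NormedAddCommGroup V] [InnerProductSpace ℝ V] [CompleteSpace V]

theorem apply_dualGradient (g : StrongDual ℝ V → ℝ) (x φ : StrongDual ℝ V) :
    φ (dualGradient g x) = fderiv ℝ g x φ := by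
  rw [dualGradient, apply_ofBidual]

theorem MemSigmaZero.continuous_dualGradient {g : StrongDual ℝ V → ℝ} (hg : MemSigmaZero g) :
    Continuous (dualGradient g) := by
  obtain ⟨-, -, K, hK⟩ := hg
  exact lipschitzWith_ofBidual.continuous.comp hK.continuous

theorem MemSigmaZero.norm_dualGradient_le {g : StrongDual ℝ V → ℝ} (hg : MemSigmaZero g) :
    ∃ C : ℝ, 0 ≤ C ∧ ∀ x, ‖dualGradient g x‖ ≤ C * (1 + ‖x‖) := by
  obtain ⟨-, -, K, hK⟩ := hg
  refine ⟨‖dualGradient g 0‖ + K, by positivity, fun x => ?_⟩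
  have h : ‖dualGradient g x - dualGradient g 0‖ ≤ K * ‖x‖ := by
    simpa [dist_eq_norm, dualGradient] using (lipschitzWith_ofBidual.comp hK).dist_le_mul x 0
  have h2 := norm_add_le (dualGradient g x - dualGradient g 0) (dualGradient g 0)
  rw [sub_add_cancel] at h2
  have h3 : 0 ≤ ‖dualGradient g 0‖ * ‖x‖ := by positivity
  have h4 : (0 : ℝ) ≤ K := K.2
  nlinarith

end Gradient

/-- Nonnegativity of `h₀` means that the negative part of the running cost is controlled by `g₀`
alone. -/
theorem nonneg_of_conj_zero {U : Type*} [NormedAddCommGroup U] [InnerProductSpace ℝ U] {h : U → ℝ}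
    (hb : BddAbove (range fun y : U => ⟪(0 : U), y⟫ - h y)) (h0 : conj h 0 = 0) (u : U) :
    0 ≤ h u := by
  have := le_ciSup hb u
  rw [← conj, h0, inner_zero_left] at this
  linarith

/-! ### Duality between state and costate on bounded intervals -/

section Costate

variable {V : Type*} [NormedAddCommGroup V] [InnerProductSpace ℝ V]

theorem aestronglyMeasurable_apply {α : Type*} [MeasurableSpace α] {μ : Measure α}
    {φ : α → StrongDual ℝ V} {v : α → V} (hφ : AEStronglyMeasurable φ μ)
    (hv : AEStronglyMeasurable v μ) : AEStronglyMeasurable (fun a => φ a (v a)) μ :=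
  (isBoundedBilinearMap_apply (𝕜 := ℝ) (E := V) (F := ℝ)).continuous.comp_aestronglyMeasurable
    (hφ.prodMk hv)

variable {S : ℝ → StrongDual ℝ V →L[ℝ] StrongDual ℝ V} {ω lam t : ℝ}

/-- On a bounded square the discount and semigroup factors are bounded, so the kernel is dominated
by a multiple of ‖G(τ)‖‖f(σ)‖. This justifies Fubini. -/
theorem IsC0Semigroup.integrable_kernel (hS : IsC0Semigroup S)
    (hg : ∀ τ : ℝ, 0 ≤ τ → ∀ x, ‖S τ x‖ ≤ Real.exp (ω * τ) * ‖x‖) {T : ℝ}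
    {f : ℝ → StrongDual ℝ V} {G : ℝ → V} (hf : IntegrableOn f (Ioc t T))
    (hG : IntegrableOn G (Ioc t T)) :
    Integrable (fun z : ℝ × ℝ => {z : ℝ × ℝ | z.2 < z.1}.indicator
      (fun z => Real.exp (-(lam * z.1)) * S (max (z.1 - z.2) 0) (f z.2) (G z.1)) z)
      ((volume.restrict (Ioc t T)).prod (volume.restrict (Ioc t T))) := by
  refine Integrable.indicator ?_ (measurableSet_lt measurable_snd measurable_fst)
  refine Integrable.mono' ((hG.norm.mul_prod hf.norm).const_mul
    (Real.exp (|lam| * (|t| + |T|)) * Real.exp (|ω| * (T - t)))) ?_ ?_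
  · refine AEStronglyMeasurable.mul (Continuous.aestronglyMeasurable (by fun_prop))
      (aestronglyMeasurable_apply ?_ hG.aestronglyMeasurable.comp_fst)
    exact hS.aestronglyMeasurable_comp hg (Continuous.aestronglyMeasurable (by fun_prop))
      hf.aestronglyMeasurable.comp_snd
  · rw [Measure.prod_restrict]
    refine (ae_restrict_iff' (measurableSet_Ioc.prod measurableSet_Ioc)).2 (ae_of_all _ ?_)
    rintro ⟨τ, σ⟩ ⟨hτ, hσ⟩
    simp only [mem_Ioc] at hτ hσ ⊢
    have h1 : |τ| ≤ |t| + |T| := abs_le.2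
      ⟨by linarith [neg_abs_le t, abs_nonneg T], by linarith [le_abs_self T, abs_nonneg t]⟩
    have h2 : max (τ - σ) 0 ≤ T - t := max_le (by linarith) (by linarith)
    have h3 : -(lam * τ) ≤ |lam| * (|t| + |T|) :=
      calc -(lam * τ) ≤ |lam * τ| := neg_le_abs _
        _ ≤ _ := by rw [abs_mul]; gcongr
    have h4 : ω * max (τ - σ) 0 ≤ |ω| * (T - t) := by
      gcongr
      exact le_abs_self ω
    rw [norm_mul, Real.norm_eq_abs, Real.abs_exp, mul_assoc]
    gcongr
    calc ‖S (max (τ - σ) 0) (f σ) (G τ)‖ ≤ ‖S (max (τ - σ) 0) (f σ)‖ * ‖G τ‖ :=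
          ContinuousLinearMap.le_opNorm _ _
      _ ≤ Real.exp (ω * max (τ - σ) 0) * ‖f σ‖ * ‖G τ‖ := by
          gcongr; exact hg _ (le_max_right _ _) _
      _ ≤ Real.exp (|ω| * (T - t)) * ‖f σ‖ * ‖G τ‖ := by gcongr
      _ = _ := by ring

theorem setIntegral_Ioc_indicator_Ioi {t T σ : ℝ} (hσ : t ≤ σ) (F : ℝ → ℝ) :
    ∫ τ in Ioc t T, (Ioi σ).indicator F τ = ∫ τ in Ioc σ T, F τ := by
  rw [setIntegral_indicator measurableSet_Ioi, Ioc_inter_Ioi, max_eq_right hσ]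

theorem IsC0Semigroup.integral_duhamel_apply (hS : IsC0Semigroup S)
    (hg : ∀ τ : ℝ, 0 ≤ τ → ∀ x, ‖S τ x‖ ≤ Real.exp (ω * τ) * ‖x‖) {T : ℝ}
    {f : ℝ → StrongDual ℝ V} {G : ℝ → V} (hf : IntegrableOn f (Ioc t T))
    (hG : IntegrableOn G (Ioc t T)) :
    IntegrableOn (fun τ => Real.exp (-(lam * τ)) * duhamel S t f τ (G τ)) (Ioc t T) ∧
    IntegrableOn (fun σ => ∫ τ in Ioc σ T, Real.exp (-(lam * τ)) * S (τ - σ) (f σ) (G τ))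
      (Ioc t T) ∧
    ∫ τ in Ioc t T, Real.exp (-(lam * τ)) * duhamel S t f τ (G τ) =
      ∫ σ in Ioc t T, ∫ τ in Ioc σ T, Real.exp (-(lam * τ)) * S (τ - σ) (f σ) (G τ) := by
  have hk := hS.integrable_kernel (lam := lam) hg hf hG
  have h1 : ∀ τ ∈ Ioc t T, (∫ σ in Ioc t T, {z : ℝ × ℝ | z.2 < z.1}.indicator
      (fun z => Real.exp (-(lam * z.1)) * S (max (z.1 - z.2) 0) (f z.2) (G z.1)) (τ, σ)) =
      Real.exp (-(lam * τ)) * duhamel S t f τ (G τ) := fun τ hτ => by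
    have h2 : ∀ σ, {z : ℝ × ℝ | z.2 < z.1}.indicator
      (fun z => Real.exp (-(lam * z.1)) * S (max (z.1 - z.2) 0) (f z.2) (G z.1)) (τ, σ) =
        (Iio τ).indicator (fun σ => Real.exp (-(lam * τ)) * S (max (τ - σ) 0) (f σ) (G τ)) σ :=
      fun σ => by simp [indicator_apply]
    simp only [h2]
    rw [setIntegral_indicator measurableSet_Iio]
    have h3 : Ioc t T ∩ Iio τ = Ioo t τ := by
      ext σ; simp only [mem_inter_iff, mem_Ioc, mem_Iio, mem_Ioo]
      exact ⟨fun h => ⟨h.1.1, h.2⟩, fun h => ⟨⟨h.1, h.2.le.trans hτ.2⟩, h.2⟩⟩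
    rw [h3, ← integral_Ioc_eq_integral_Ioo, integral_const_mul, duhamel_eq_setIntegral hτ.1.le]
    congr 1
    exact (ContinuousLinearMap.integral_apply
      (hS.integrableOn_comp hg (hf.mono_set (Ioc_subset_Ioc_right hτ.2))) (G τ)).symm
  have h4 : ∀ σ ∈ Ioc t T, (∫ τ in Ioc t T, {z : ℝ × ℝ | z.2 < z.1}.indicator
      (fun z => Real.exp (-(lam * z.1)) * S (max (z.1 - z.2) 0) (f z.2) (G z.1)) (τ, σ)) =
      ∫ τ in Ioc σ T, Real.exp (-(lam * τ)) * S (τ - σ) (f σ) (G τ) := fun σ hσ => by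
    have h5 : ∀ τ, {z : ℝ × ℝ | z.2 < z.1}.indicator
      (fun z => Real.exp (-(lam * z.1)) * S (max (z.1 - z.2) 0) (f z.2) (G z.1)) (τ, σ) =
        (Ioi σ).indicator (fun τ => Real.exp (-(lam * τ)) * S (max (τ - σ) 0) (f σ) (G τ)) τ :=
      fun τ => by simp [indicator_apply]
    simp only [h5]
    rw [setIntegral_Ioc_indicator_Ioi hσ.1.le]
    refine setIntegral_congr_fun measurableSet_Ioc fun τ hτ => ?_
    simp only [max_eq_left (sub_nonneg.2 hτ.1.le)]
  refine ⟨?_, ?_, ?_⟩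
  · exact hk.integral_prod_left.congr
      ((ae_restrict_iff' measurableSet_Ioc).2 (ae_of_all _ h1))
  · exact hk.integral_prod_right.congr
      ((ae_restrict_iff' measurableSet_Ioc).2 (ae_of_all _ h4))
  · rw [← setIntegral_congr_fun measurableSet_Ioc h1, ← setIntegral_congr_fun measurableSet_Ioc h4]
    exact integral_integral_swap hk

variable [CompleteSpace V] {g₀ : StrongDual ℝ V → ℝ} {y : ℝ → StrongDual ℝ V} {π : ℝ → V}

theorem IsMildCostate.apply (hπ : IsMildCostate S g₀ lam t y π) {τ : ℝ} (hτ : t ≤ τ)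
    (φ : StrongDual ℝ V) :
    IntegrableOn (fun σ => Real.exp (-(lam * (σ - τ))) *
      S (σ - τ) φ (dualGradient g₀ (y σ))) (Ioi τ) ∧
    φ (π τ) = ∫ σ in Ioi τ, Real.exp (-(lam * (σ - τ))) *
      S (σ - τ) φ (dualGradient g₀ (y σ)) := by
  obtain ⟨h1, h2⟩ := hπ τ hτ
  have h3 : ∀ σ, φ (Real.exp (-(lam * (σ - τ))) •
      dualityAdjoint (S (σ - τ)) (dualGradient g₀ (y σ))) =
      Real.exp (-(lam * (σ - τ))) * S (σ - τ) φ (dualGradient g₀ (y σ)) := fun σ => by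
    rw [map_smul, apply_dualityAdjoint, smul_eq_mul]
  refine ⟨(φ.integrable_comp h1).congr (ae_of_all _ h3), ?_⟩
  rw [h2, ← φ.integral_comp_comm h1]
  simp only [h3]

/-- Splitting the defining integral at `T` and applying the semigroup law on the tail shows that the
tail is π(T) transported back to time σ. -/
theorem IsMildCostate.apply_eq_add (hS : IsC0Semigroup S) (hπ : IsMildCostate S g₀ lam t y π)
    {σ T : ℝ} (hσ : t ≤ σ) (hT : σ ≤ T) (φ : StrongDual ℝ V) :
    Real.exp (-(lam * σ)) * φ (π σ) =
      (∫ τ in Ioc σ T, Real.exp (-(lam * τ)) * S (τ - σ) φ (dualGradient g₀ (y τ))) +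
        Real.exp (-(lam * T)) * S (T - σ) φ (π T) := by
  obtain ⟨h1, h2⟩ := hπ.apply hσ φ
  obtain ⟨-, h4⟩ := hπ.apply (hσ.trans hT) (S (T - σ) φ)
  rw [← Ioc_union_Ioi_eq_Ioi hT] at h1 h2
  rw [setIntegral_union (Ioc_disjoint_Ioi le_rfl) measurableSet_Ioi
    (h1.mono_set subset_union_left) (h1.mono_set subset_union_right)] at h2
  rw [h2, h4, mul_add, ← integral_const_mul, ← integral_const_mul, ← integral_const_mul]
  congr 1
  · refine setIntegral_congr_fun measurableSet_Ioc fun τ _ => ?_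
    simp only [← mul_assoc, ← Real.exp_add]
    congr 2; ring
  · refine setIntegral_congr_fun measurableSet_Ioi fun τ hτ => ?_
    have h5 : S (τ - σ) φ = S (τ - T) (S (T - σ) φ) := by
      rw [show τ - σ = (τ - T) + (T - σ) by ring,
        hS.map_add _ _ (sub_nonneg.2 (mem_Ioi.1 hτ).le) (sub_nonneg.2 hT)]
      rfl
    simp only [h5, ← mul_assoc, ← Real.exp_add]
    congr 2; ring

/-- Duality between the state and the costate on a bounded time interval. -/
theorem IsMildCostate.duality (hS : IsC0Semigroup S)
    (hg : ∀ τ : ℝ, 0 ≤ τ → ∀ x, ‖S τ x‖ ≤ Real.exp (ω * τ) * ‖x‖)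
    (hπ : IsMildCostate S g₀ lam t y π) {T : ℝ} (hT : t ≤ T) {f : ℝ → StrongDual ℝ V}
    (hf : IntegrableOn f (Ioc t T))
    (hG : IntegrableOn (fun τ => dualGradient g₀ (y τ)) (Ioc t T)) :
    IntegrableOn (fun τ => Real.exp (-(lam * τ)) * duhamel S t f τ (dualGradient g₀ (y τ)))
      (Ioc t T) ∧
    IntegrableOn (fun σ => Real.exp (-(lam * σ)) * f σ (π σ)) (Ioc t T) ∧
    ∫ τ in Ioc t T, Real.exp (-(lam * τ)) * duhamel S t f τ (dualGradient g₀ (y τ)) =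
      (∫ σ in Ioc t T, Real.exp (-(lam * σ)) * f σ (π σ)) -
        Real.exp (-(lam * T)) * duhamel S t f T (π T) := by
  obtain ⟨h1, h2, h3⟩ := hS.integral_duhamel_apply (lam := lam) hg hf hG
  have h0 : IntegrableOn (fun σ => S (max (T - σ) 0) (f σ)) (Ioc t T) := hS.integrableOn_comp hg hf
  have h4 : IntegrableOn (fun σ => Real.exp (-(lam * T)) * S (max (T - σ) 0) (f σ) (π T))
      (Ioc t T) := (h0.apply_continuousLinearMap (π T)).const_mul _
  -- The inner Fubini integral plus the transported terminal value is e^{-λσ}⟨f(σ), π(σ)⟩. This also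
  -- gives integrability of that pairing, with no prior measurability of π.
  have h5 : ∀ σ ∈ Ioc t T, (∫ τ in Ioc σ T, Real.exp (-(lam * τ)) *
      S (τ - σ) (f σ) (dualGradient g₀ (y τ))) + Real.exp (-(lam * T)) *
        S (max (T - σ) 0) (f σ) (π T) = Real.exp (-(lam * σ)) * f σ (π σ) := fun σ hσ => by
    rw [max_eq_left (sub_nonneg.2 hσ.2), hπ.apply_eq_add hS hσ.1.le hσ.2]
  refine ⟨h1, (h2.add h4).congr ((ae_restrict_iff' measurableSet_Ioc).2 (ae_of_all _ h5)), ?_⟩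
  rw [h3, ← setIntegral_congr_fun measurableSet_Ioc h5, integral_add h2 h4, integral_const_mul,
    ← ContinuousLinearMap.integral_apply h0, ← duhamel_eq_setIntegral hT]
  ring

end Costate

/-! ### Extended-real costs as limits over bounded intervals -/

section RunningIntegral

theorem tendsto_setLIntegral_Ioc (t : ℝ) {f : ℝ → ℝ≥0∞}
    (hf : AEMeasurable f (volume.restrict (Ici t))) :
    Tendsto (fun T => ∫⁻ τ in Ioc t T, f τ) atTop (𝓝 (∫⁻ τ in Ici t, f τ)) := by
  rw [← restrict_Ioi_eq_restrict_Ici] at hf ⊢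
  have h := (aecover_Iic (μ := volume.restrict (Ioi t))
    tendsto_id).lintegral_tendsto_of_countably_generated hf
  refine h.congr fun T => ?_
  rw [Measure.restrict_restrict measurableSet_Iic, inter_comm, Ioi_inter_Iic]
  rfl

/-- The positive and negative parts converge monotonically; having one of them finite excludes ⊤ -
⊤, so subtraction is continuous at the limit. -/
theorem tendsto_setIntegral_Ioc_ereal {t : ℝ} {f : ℝ → ℝ}
    (hf : ∀ T, IntegrableOn f (Ioc t T)) (hm : AEMeasurable f (volume.restrict (Ici t)))
    (hd : (∫⁻ τ in Ici t, ENNReal.ofReal (f τ)) ≠ ⊤ ∨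
      (∫⁻ τ in Ici t, ENNReal.ofReal (-f τ)) ≠ ⊤) :
    Tendsto (fun T => ((∫ τ in Ioc t T, f τ : ℝ) : EReal)) atTop
      (𝓝 (((∫⁻ τ in Ici t, ENNReal.ofReal (f τ) : ℝ≥0∞) : EReal) -
        ((∫⁻ τ in Ici t, ENNReal.ofReal (-f τ) : ℝ≥0∞) : EReal))) := by
  have h1 := (continuous_coe_ennreal_ereal.tendsto _).comp
    (tendsto_setLIntegral_Ioc t hm.ennreal_ofReal)
  have h2 := (continuous_coe_ennreal_ereal.tendsto _).comp
    (tendsto_setLIntegral_Ioc t hm.neg.ennreal_ofReal)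
  have h3 := (continuous_neg (G := EReal)).tendsto _ |>.comp h2
  have h4 := EReal.continuousAt_add (p := (((∫⁻ τ in Ici t, ENNReal.ofReal (f τ) : ℝ≥0∞) : EReal),
    -((∫⁻ τ in Ici t, ENNReal.ofReal (-f τ) : ℝ≥0∞) : EReal))) ?_ ?_
  · refine (h4.tendsto.comp (h1.prodMk_nhds h3)).congr fun T => ?_
    have h5 : (∫⁻ τ in Ioc t T, ENNReal.ofReal (f τ)) ≠ ⊤ := (hf T).lintegral_lt_top.ne
    have h6 : (∫⁻ τ in Ioc t T, ENNReal.ofReal (-f τ)) ≠ ⊤ := (hf T).neg.lintegral_lt_top.ne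
    rw [integral_eq_lintegral_pos_part_sub_lintegral_neg_part (hf T), EReal.coe_sub,
      EReal.coe_ennreal_toReal h5, EReal.coe_ennreal_toReal h6]
    rfl
  · simpa [or_comm] using hd.symm
  · simp

theorem ereal_cost_le_of_add_le {t : ℝ} {f g k : ℝ → ℝ} {T : ℕ → ℝ}
    (hf : ∀ T, IntegrableOn f (Ioc t T)) (hg : ∀ T, IntegrableOn g (Ioc t T))
    (hk : ∀ T, IntegrableOn k (Ioc t T))
    (hfm : AEMeasurable f (volume.restrict (Ici t)))
    (hgm : AEMeasurable g (volume.restrict (Ici t)))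
    (hfd : (∫⁻ τ in Ici t, ENNReal.ofReal (f τ)) ≠ ⊤ ∨
      (∫⁻ τ in Ici t, ENNReal.ofReal (-f τ)) ≠ ⊤)
    (hgd : (∫⁻ τ in Ici t, ENNReal.ofReal (g τ)) ≠ ⊤ ∨
      (∫⁻ τ in Ici t, ENNReal.ofReal (-g τ)) ≠ ⊤)
    (hle : ∀ᵐ τ ∂volume.restrict (Ici t), f τ + k τ ≤ g τ)
    (hT : Tendsto T atTop atTop)
    (hkT : Tendsto (fun n => ∫ τ in Ioc t (T n), k τ) atTop (𝓝 0)) :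
    ((∫⁻ τ in Ici t, ENNReal.ofReal (f τ) : ℝ≥0∞) : EReal) -
        ((∫⁻ τ in Ici t, ENNReal.ofReal (-f τ) : ℝ≥0∞) : EReal) ≤
      ((∫⁻ τ in Ici t, ENNReal.ofReal (g τ) : ℝ≥0∞) : EReal) -
        ((∫⁻ τ in Ici t, ENNReal.ofReal (-g τ) : ℝ≥0∞) : EReal) := by
  have h1 := (tendsto_setIntegral_Ioc_ereal hf hfm hfd).comp hT
  have h2 := (tendsto_setIntegral_Ioc_ereal hg hgm hgd).comp hT
  have h3 := (continuous_coe_real_ereal.tendsto _).comp hkT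
  have h4 := (EReal.continuousAt_add (p := (((∫⁻ τ in Ici t, ENNReal.ofReal (f τ) : ℝ≥0∞) : EReal) -
    ((∫⁻ τ in Ici t, ENNReal.ofReal (-f τ) : ℝ≥0∞) : EReal), ((0 : ℝ) : EReal)))
    (by simp) (by simp)).tendsto.comp (h1.prodMk_nhds h3)
  simp only [EReal.coe_zero, add_zero] at h4
  refine le_of_tendsto_of_tendsto' h4 h2 fun n => ?_
  simp only [Function.comp]
  rw [← EReal.coe_add, EReal.coe_le_coe_iff, ← integral_add (hf _) (hk _)]
  exact integral_mono_ae ((hf _).add (hk _)) (hg _)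
    (ae_mono (Measure.restrict_mono (Ioc_subset_Icc_self.trans Icc_subset_Ici_self) le_rfl) hle)

/-- If h stayed above 1/(n+1) at all times beyond n, its r-th power would have infinite integral.
Only a sequence is obtained, which is enough for the boundary term. -/
theorem exists_seq_tendsto_zero_of_lintegral {t r : ℝ} (hr : 0 < r) {h : ℝ → ℝ≥0∞}
    (hh : (∫⁻ τ in Ici t, h τ ^ r) ≠ ⊤) :
    ∃ T : ℕ → ℝ, Tendsto T atTop atTop ∧ Tendsto (fun n => h (T n)) atTop (𝓝 0) := by
  have h1 : ∀ n : ℕ, ∃ T : ℝ, (n : ℝ) ≤ T ∧ h T ≤ ((n : ℝ≥0∞) + 1)⁻¹ := by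
    intro n
    by_contra! hcon
    refine hh (top_le_iff.1 ?_)
    calc (⊤ : ℝ≥0∞) = ∫⁻ _ in Ici (max t n), ((n : ℝ≥0∞) + 1)⁻¹ ^ r := by
          rw [setLIntegral_const, Real.volume_Ici, ENNReal.mul_top]
          exact (ENNReal.rpow_pos (ENNReal.inv_pos.2 (by simp)) (by simp)).ne'
      _ ≤ ∫⁻ τ in Ici (max t n), h τ ^ r := setLIntegral_mono' measurableSet_Ici fun τ hτ =>
          ENNReal.rpow_le_rpow (hcon τ ((le_max_right _ _).trans hτ)).le hr.le
      _ ≤ _ := lintegral_mono_set (Ici_subset_Ici.2 (le_max_left _ _))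
  choose T hT1 hT2 using h1
  refine ⟨T, tendsto_atTop_mono hT1 tendsto_natCast_atTop_atTop, ?_⟩
  refine tendsto_of_tendsto_of_tendsto_of_le_of_le tendsto_const_nhds ?_ (fun _ => zero_le) hT2
  have h3 := (tendsto_add_atTop_iff_nat 1).2 ENNReal.tendsto_inv_nat_nhds_zero
  simpa using h3

end RunningIntegral

/-! ### Weighted estimates for states and costates -/

section StateEstimates

variable {X : Type*} [NormedAddCommGroup X] [NormedSpace ℝ X] {S : ℝ → X →L[ℝ] X} {ω : ℝ}

theorem IsC0Semigroup.memWeightedLp_two_orbit (hS : IsC0Semigroup S)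
    (hg : ∀ τ : ℝ, 0 ≤ τ → ∀ x : X, ‖S τ x‖ ≤ Real.exp (ω * τ) * ‖x‖) {lam t : ℝ}
    (hω : 2 * ω < lam) (x : X) : MemWeightedLp 2 lam t fun τ => S (max (τ - t) 0) x := by
  have hm : AEStronglyMeasurable (fun τ => S (max (τ - t) 0) x) (volume.restrict (Ici t)) :=
    hS.aestronglyMeasurable_comp hg (Continuous.aestronglyMeasurable (by fun_prop))
      aestronglyMeasurable_const
  rw [MemWeightedLp, ENNReal.ofReal_ofNat, memLp_two_iff_integrable_sq_norm
    ((aestronglyMeasurable_exp_smul (by fun_prop)).2 hm)]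
  have h1 : IntegrableOn (fun τ : ℝ => Real.exp (-(2 * ω * t)) * ‖x‖ ^ 2 *
      Real.exp ((2 * ω - lam) * τ)) (Ici t) := by
    rw [integrableOn_Ici_iff_integrableOn_Ioi]
    exact (integrableOn_exp_mul_Ioi (by linarith) t).const_mul _
  refine Integrable.mono' h1 (((aestronglyMeasurable_exp_smul (by fun_prop)).2 hm).norm.pow 2)
    ((ae_restrict_iff' measurableSet_Ici).2 (ae_of_all _ fun τ hτ => ?_))
  have h2 := sub_nonneg.2 (mem_Ici.1 hτ)
  rw [max_eq_left h2, Real.norm_of_nonneg (by positivity), norm_smul, Real.norm_eq_abs,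
    Real.abs_exp]
  calc (Real.exp (-(lam * τ / 2)) * ‖S (τ - t) x‖) ^ 2
      ≤ (Real.exp (-(lam * τ / 2)) * (Real.exp (ω * (τ - t)) * ‖x‖)) ^ 2 := by
        gcongr; exact hg _ h2 _
    _ = _ := by
      rw [mul_pow, mul_pow, ← Real.exp_nat_mul, ← Real.exp_nat_mul, ← mul_assoc, ← Real.exp_add,
        mul_right_comm, ← Real.exp_add]
      congr 2; push_cast; ring

end StateEstimates

section State

variable {V : Type*} [NormedAddCommGroup V] [InnerProductSpace ℝ V]
variable {U : Type*} [NormedAddCommGroup U] [InnerProductSpace ℝ U]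
variable {S : ℝ → StrongDual ℝ V →L[ℝ] StrongDual ℝ V} {B : U →L[ℝ] StrongDual ℝ V}
  {ω lam t : ℝ} {x : StrongDual ℝ V} {u : ℝ → U} {y : ℝ → StrongDual ℝ V}

theorem IsMildState.eq_duhamel (hy : IsMildState S B t x u y) {τ : ℝ} (hτ : t ≤ τ) :
    y τ = S (max (τ - t) 0) x + duhamel S t (fun σ => B (u σ)) τ := by
  rw [hy.2 τ hτ, max_eq_left (sub_nonneg.2 hτ)]; rfl

theorem IsMildState.aestronglyMeasurable (hy : IsMildState S B t x u y) :
    AEStronglyMeasurable y (volume.restrict (Ici t)) :=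
  hy.1.aestronglyMeasurable

theorem IsMildState.memWeightedLp_two (hS : IsC0Semigroup S)
    (hg : ∀ τ : ℝ, 0 ≤ τ → ∀ x, ‖S τ x‖ ≤ Real.exp (ω * τ) * ‖x‖) (hω : 2 * ω < lam)
    (hy : IsMildState S B t x u y) (hu : MemWeightedLp 2 lam t u) : MemWeightedLp 2 lam t y := by
  have h := (hS.memWeightedLp_two_orbit hg hω x (t := t)).add
    (hS.memWeightedLp_duhamel hg one_le_two (by linarith) (hu.comp_clm B))
  refine MemLp.ae_eq ((ae_restrict_iff' measurableSet_Ici).2 (ae_of_all _ fun τ hτ => ?_)) h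
  simp only [hy.eq_duhamel hτ]

theorem IsMildState.exists_norm_le
    (hg : ∀ τ : ℝ, 0 ≤ τ → ∀ x, ‖S τ x‖ ≤ Real.exp (ω * τ) * ‖x‖)
    (hy : IsMildState S B t x u y) (hu : ∀ T, IntegrableOn u (Icc t T)) (T : ℝ) :
    ∃ M : ℝ, 0 ≤ M ∧ ∀ τ ∈ Icc t T, ‖y τ‖ ≤ M := by
  have hBu : IntegrableOn (fun σ => B (u σ)) (Ioc t T) :=
    B.integrable_comp ((hu T).mono_set Ioc_subset_Icc_self)
  refine ⟨Real.exp (|ω| * (T - t)) * ‖x‖ +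
    Real.exp (|ω| * (T - t)) * ∫ σ in Ioc t T, ‖B (u σ)‖, by positivity, fun τ hτ => ?_⟩
  rw [hy.eq_duhamel hτ.1, max_eq_left (sub_nonneg.2 hτ.1)]
  refine (norm_add_le _ _).trans (add_le_add ((hg _ (sub_nonneg.2 hτ.1) _).trans ?_)
    (norm_duhamel_le hg hτ.1 hτ.2 hBu))
  gcongr
  · exact sub_nonneg.2 hτ.1
  · exact le_abs_self ω
  · exact hτ.2

theorem IsMildState.integrableOn_comp
    (hg : ∀ τ : ℝ, 0 ≤ τ → ∀ x, ‖S τ x‖ ≤ Real.exp (ω * τ) * ‖x‖)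
    (hy : IsMildState S B t x u y) (hu : ∀ T, IntegrableOn u (Icc t T))
    {Y : Type*} [NormedAddCommGroup Y] {F : StrongDual ℝ V → Y} (hF : Continuous F)
    {C : ℝ} (hC : 0 ≤ C) (hFC : ∀ z, ‖F z‖ ≤ C * (1 + ‖z‖ ^ 2)) (T : ℝ) :
    IntegrableOn (fun τ => F (y τ)) (Ioc t T) := by
  obtain ⟨M, hM, hyM⟩ := hy.exists_norm_le hg hu T
  refine Integrable.mono' (integrable_const (C * (1 + M ^ 2)))
    (hF.comp_aestronglyMeasurable (hy.aestronglyMeasurable.mono_measure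
      (Measure.restrict_mono (Ioc_subset_Icc_self.trans Icc_subset_Ici_self) le_rfl)))
    ((ae_restrict_iff' measurableSet_Ioc).2 (ae_of_all _ fun τ hτ => (hFC _).trans ?_))
  gcongr
  exact hyM τ ⟨hτ.1.le, hτ.2⟩

variable [CompleteSpace V]

theorem MemSigmaZero.exists_norm_dualGradient_le_sq {g : StrongDual ℝ V → ℝ} (hg : MemSigmaZero g) :
    ∃ C : ℝ, 0 ≤ C ∧ ∀ x, ‖dualGradient g x‖ ≤ C * (1 + ‖x‖ ^ 2) := by
  obtain ⟨C, hC, h⟩ := hg.norm_dualGradient_le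
  refine ⟨2 * C, by positivity, fun x => (h x).trans ?_⟩
  nlinarith [mul_nonneg hC (sq_nonneg (‖x‖ - 1)), mul_nonneg hC (sq_nonneg ‖x‖)]

theorem MemSigmaZero.memWeightedLp_dualGradient {g : StrongDual ℝ V → ℝ} (hg : MemSigmaZero g)
    (hlam : 0 < lam) {r : ℝ} (hr : 0 < r) (hy : MemWeightedLp r lam t y) :
    MemWeightedLp r lam t fun τ => dualGradient g (y τ) := by
  obtain ⟨C, hC, h⟩ := hg.norm_dualGradient_le
  have := isFiniteMeasure_discount hlam t
  rw [memWeightedLp_iff hr] at hy ⊢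
  have h0 : MemLp (fun _ : ℝ => (1 : ℝ)) (ENNReal.ofReal r) (discount lam t) := memLp_const 1
  have h1 := (h0.add hy.norm).const_mul C
  exact h1.mono' (hg.continuous_dualGradient.comp_aestronglyMeasurable hy.1)
    (ae_of_all _ fun τ => h (y τ))

/-- Here the kernel looks forward, with σ > τ: discount and growth give e^{-(λ-ω)(σ-τ)}, and moving
the weight from τ to σ costs e^{(λ/r)(σ-τ)}. For r = 2 the rate λ - λ/r - ω is λ/2 - ω, positive
exactly when 2ω < λ. -/
theorem lintegral_enorm_costate_le
    (hg : ∀ τ : ℝ, 0 ≤ τ → ∀ x, ‖S τ x‖ ≤ Real.exp (ω * τ) * ‖x‖) (r : ℝ)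
    {τ : ℝ} (hτ : t ≤ τ) (G : ℝ → V) :
    (∫⁻ σ in Ioi τ, ‖Real.exp (-(lam * τ / r)) • Real.exp (-(lam * (σ - τ))) •
        dualityAdjoint (S (σ - τ)) (G σ)‖ₑ) ≤
      expConv (lam - lam / r - ω) (weightedNorm r lam t G) τ := by
  rw [expConv, ← lintegral_indicator measurableSet_Ioi]
  refine lintegral_mono fun σ => ?_
  refine indicator_apply_le' (fun hσ => ?_) (fun _ => zero_le)
  have h1 := sub_nonneg.2 (mem_Ioi.1 hσ).le
  rw [weightedNorm, indicator_of_mem (show σ ∈ Ici t from hτ.trans (mem_Ioi.1 hσ).le),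
    abs_of_nonpos (by linarith), ← Real.enorm_eq_ofReal (Real.exp_pos _).le,
    ← enorm_norm (Real.exp (-(lam * σ / r)) • G σ), ← enorm_mul, enorm_le_iff_norm_le]
  rw [norm_smul, norm_smul, norm_mul, norm_norm, norm_smul]
  simp only [Real.norm_eq_abs, Real.abs_exp]
  calc Real.exp (-(lam * τ / r)) * (Real.exp (-(lam * (σ - τ))) *
        ‖dualityAdjoint (S (σ - τ)) (G σ)‖)
      ≤ Real.exp (-(lam * τ / r)) * (Real.exp (-(lam * (σ - τ))) *
        (Real.exp (ω * (σ - τ)) * ‖G σ‖)) := by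
        gcongr; exact norm_dualityAdjoint_le (Real.exp_pos _).le (hg _ h1) _
    _ = _ := by
      simp only [← mul_assoc, ← Real.exp_add]
      congr 2; ring

theorem enorm_exp_smul_costate_le
    (hg : ∀ τ : ℝ, 0 ≤ τ → ∀ x, ‖S τ x‖ ≤ Real.exp (ω * τ) * ‖x‖) (r : ℝ)
    {τ : ℝ} (hτ : t ≤ τ) (G : ℝ → V) :
    ‖Real.exp (-(lam * τ / r)) • ∫ σ in Ioi τ, Real.exp (-(lam * (σ - τ))) •
        dualityAdjoint (S (σ - τ)) (G σ)‖ₑ ≤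
      expConv (lam - lam / r - ω) (weightedNorm r lam t G) τ := by
  rw [← integral_smul]
  exact (enorm_integral_le_lintegral_enorm _).trans (lintegral_enorm_costate_le hg r hτ G)

end State

theorem integrable_max_zero {α : Type*} [MeasurableSpace α] {μ : Measure α} {f : α → ℝ}
    (hf : AEStronglyMeasurable f μ) (h : (∫⁻ a, ENNReal.ofReal (f a) ∂μ) ≠ ⊤) :
    Integrable (fun a => max (f a) 0) μ := by
  refine ⟨hf.sup aestronglyMeasurable_const, ?_⟩
  have h1 : ∀ a, ‖max (f a) 0‖ₑ = ENNReal.ofReal (f a) := fun a => by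
    rw [Real.enorm_eq_ofReal (le_max_right _ _)]; simp
  change (∫⁻ a, ‖max (f a) 0‖ₑ ∂μ) < ⊤
  simp only [h1]
  exact lt_top_iff_ne_top.2 h

/-! ### Vanishing of the boundary term -/

section Boundary

variable {V : Type*} [NormedAddCommGroup V] [InnerProductSpace ℝ V]
variable {S : ℝ → StrongDual ℝ V →L[ℝ] StrongDual ℝ V} {ω lam t : ℝ}
  {g₀ : StrongDual ℝ V → ℝ} {y : ℝ → StrongDual ℝ V} {π : ℝ → V}

theorem exp_mul_apply_eq {r s : ℝ} (hrs : lam / r + lam / s = lam) (T : ℝ)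
    (φ : StrongDual ℝ V) (v : V) :
    Real.exp (-(lam * T)) * φ v =
      (Real.exp (-(lam * T / r)) • φ) (Real.exp (-(lam * T / s)) • v) := by
  have h : -(lam * T) = -(lam * T / r) + -(lam * T / s) := by
    calc -(lam * T) = -((lam / r + lam / s) * T) := by rw [hrs]
      _ = _ := by ring
  rw [smul_apply, map_smul, smul_eq_mul, smul_eq_mul, h, Real.exp_add, mul_assoc]

theorem tendsto_apply_zero {α : Type*} {l : Filter α} {φ : α → StrongDual ℝ V} {v : α → V}
    (hφ : Tendsto φ l (𝓝 0)) (hv : Tendsto v l (𝓝 0)) : Tendsto (fun a => φ a (v a)) l (𝓝 0) := by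
  have h := ((isBoundedBilinearMap_apply (𝕜 := ℝ) (E := V) (F := ℝ)).continuous.tendsto
    (0, 0)).comp (hφ.prodMk_nhds hv)
  rw [zero_apply] at h
  exact h

/-- The weight e^{-λT} splits as e^{-λT/p} e^{-λT/q}. The state factor tends to zero along all
times, the costate factor only along times selected from its L^q integrability. -/
theorem exists_seq_tendsto_duhamel_apply
    (hg : ∀ τ : ℝ, 0 ≤ τ → ∀ x, ‖S τ x‖ ≤ Real.exp (ω * τ) * ‖x‖) {p q : ℝ}
    (hpq : p.HolderConjugate q) (hω : ω < lam / p) {f : ℝ → StrongDual ℝ V}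
    (hf : MemWeightedLp p lam t f) (hπ : MemWeightedLp q lam t π) :
    ∃ T : ℕ → ℝ, Tendsto T atTop atTop ∧ Tendsto
      (fun n => Real.exp (-(lam * T n)) * duhamel S t f (T n) (π (T n))) atTop (𝓝 0) := by
  have hq := hpq.symm.pos
  have h := (eLpNorm_lt_top_iff_lintegral_rpow_enorm_lt_top (by simpa using hq)
    ENNReal.ofReal_ne_top).1 hπ.2
  rw [ENNReal.toReal_ofReal hq.le] at h
  obtain ⟨T, hT, hT0⟩ := exists_seq_tendsto_zero_of_lintegral hq h.ne
  refine ⟨T, hT, ?_⟩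
  have hrs : lam / p + lam / q = lam := by
    rw [div_eq_mul_inv, div_eq_mul_inv, ← mul_add, hpq.inv_add_inv_eq_one, mul_one]
  simp only [exp_mul_apply_eq hrs]
  exact tendsto_apply_zero ((tendsto_exp_smul_duhamel hg hpq.lt.le hω hf).comp hT)
    (tendsto_zero_iff_enorm_tendsto_zero.2 hT0)

variable [CompleteSpace V]

theorem IsMildCostate.tendsto_exp_smul
    (hg : ∀ τ : ℝ, 0 ≤ τ → ∀ x, ‖S τ x‖ ≤ Real.exp (ω * τ) * ‖x‖)
    (hω : 2 * ω < lam) (hπ : IsMildCostate S g₀ lam t y π)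
    (hG : MemWeightedLp 2 lam t fun τ => dualGradient g₀ (y τ)) :
    Tendsto (fun τ => Real.exp (-(lam * τ / 2)) • π τ) atTop (𝓝 0) := by
  refine tendsto_of_le_expConv one_le_two (c := lam - lam / 2 - ω) (by linarith) hG
    fun τ hτ => ?_
  rw [(hπ τ hτ).2]
  exact enorm_exp_smul_costate_le hg 2 hτ _

theorem IsMildCostate.tendsto_duhamel_apply
    (hg : ∀ τ : ℝ, 0 ≤ τ → ∀ x, ‖S τ x‖ ≤ Real.exp (ω * τ) * ‖x‖)
    (hω : 2 * ω < lam) (hπ : IsMildCostate S g₀ lam t y π) {f : ℝ → StrongDual ℝ V}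
    (hf : MemWeightedLp 2 lam t f)
    (hG : MemWeightedLp 2 lam t fun τ => dualGradient g₀ (y τ)) :
    Tendsto (fun T => Real.exp (-(lam * T)) * duhamel S t f T (π T)) atTop (𝓝 0) := by
  simp only [exp_mul_apply_eq (add_halves lam)]
  exact tendsto_apply_zero (tendsto_exp_smul_duhamel hg one_le_two (by linarith) hf)
    (hπ.tendsto_exp_smul hg hω hG)

end Boundary

/-! ### Sufficiency of the optimality system -/

section Sufficiency

variable {V : Type*} [NormedAddCommGroup V] [InnerProductSpace ℝ V]
variable {U : Type*} [NormedAddCommGroup U] [InnerProductSpace ℝ U]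
variable {A : StrongDual ℝ V →ₗ.[ℝ] StrongDual ℝ V} {S : ℝ → StrongDual ℝ V →L[ℝ] StrongDual ℝ V}
  {B : U →L[ℝ] StrongDual ℝ V} {g₀ : StrongDual ℝ V → ℝ} {h₀ : U → ℝ} {p ω lam t : ℝ}
  {x : StrongDual ℝ V} {u v : ℝ → U} {y z : ℝ → StrongDual ℝ V} {π : ℝ → V}

theorem MemWeightedLp.aestronglyMeasurable {X : Type*} [NormedAddCommGroup X] [NormedSpace ℝ X]
    {r : ℝ} {f : ℝ → X} (hf : MemWeightedLp r lam t f) :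
    AEStronglyMeasurable f (volume.restrict (Ici t)) :=
  (aestronglyMeasurable_exp_smul (by fun_prop)).1 hf.1

theorem StandingAssumptions.h₀_nonneg (hyp : StandingAssumptions A S g₀ h₀ p ω lam) (w : U) :
    0 ≤ h₀ w := nonneg_of_conj_zero (hyp.conj_finite 0) hyp.conj_zero w

theorem StandingAssumptions.g₀_continuous (hyp : StandingAssumptions A S g₀ h₀ p ω lam) :
    Continuous g₀ := hyp.g₀_mem.2.1.continuous

theorem duhamel_sub (hS : IsC0Semigroup S)
    (hg : ∀ τ : ℝ, 0 ≤ τ → ∀ x, ‖S τ x‖ ≤ Real.exp (ω * τ) * ‖x‖) {f g : ℝ → StrongDual ℝ V}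
    {τ : ℝ} (hτ : t ≤ τ) (hf : IntegrableOn f (Ioc t τ)) (hg' : IntegrableOn g (Ioc t τ)) :
    duhamel S t (fun σ => f σ - g σ) τ = duhamel S t f τ - duhamel S t g τ := by
  rw [duhamel_eq_setIntegral hτ, duhamel_eq_setIntegral hτ, duhamel_eq_setIntegral hτ,
    ← integral_sub (hS.integrableOn_comp hg hf) (hS.integrableOn_comp hg hg')]
  simp only [map_sub]

theorem StandingAssumptions.sub_eq_duhamel (hyp : StandingAssumptions A S g₀ h₀ p ω lam)
    (hu : MemWeightedLp p lam t u) (hv : MemWeightedLp p lam t v)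
    (hy : IsMildState S B t x u y) (hz : IsMildState S B t x v z) {τ : ℝ} (hτ : t ≤ τ) :
    z τ - y τ = duhamel S t (fun σ => B (v σ - u σ)) τ := by
  have h : ∀ {w : ℝ → U}, MemWeightedLp p lam t w → IntegrableOn (fun σ => B (w σ)) (Ioc t τ) :=
    fun hw => B.integrable_comp
      ((hw.integrableOn_Icc hyp.one_lt_p.le τ).mono_set Ioc_subset_Icc_self)
  rw [hz.eq_duhamel hτ, hy.eq_duhamel hτ, add_sub_add_left_eq_sub,
    ← duhamel_sub hyp.semigroup hyp.growth hτ (h hv) (h hu)]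
  simp only [map_sub]

theorem StandingAssumptions.neg_le_runningCost (hyp : StandingAssumptions A S g₀ h₀ p ω lam)
    (u : ℝ → U) (y : ℝ → StrongDual ℝ V) (τ : ℝ) :
    -(Real.exp (-(lam * τ)) * |g₀ (y τ)|) ≤ runningCost g₀ h₀ lam u y τ := by
  rw [runningCost, ← mul_neg]
  refine mul_le_mul_of_nonneg_left ?_ (Real.exp_pos _).le
  linarith [neg_abs_le (g₀ (y τ)), hyp.h₀_nonneg (u τ)]

theorem StandingAssumptions.integrableOn_exp_mul_g₀
    (hyp : StandingAssumptions A S g₀ h₀ p ω lam) (hu : MemWeightedLp p lam t u)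
    (hy : IsMildState S B t x u y) (T : ℝ) :
    IntegrableOn (fun τ => Real.exp (-(lam * τ)) * |g₀ (y τ)|) (Ioc t T) := by
  obtain ⟨C, hC, hgC⟩ := hyp.g₀_mem.abs_le_quadratic
  have h1 := hy.integrableOn_comp hyp.growth (fun T => hu.integrableOn_Icc hyp.one_lt_p.le T)
    hyp.g₀_continuous hC hgC T
  have h2 : ContinuousOn (fun τ : ℝ => Real.exp (-(lam * τ))) (Icc t T) := by fun_prop
  exact IntegrableOn.continuousOn_smul_of_subset h2 h1.abs isCompact_Icc measurableSet_Ioc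
    Ioc_subset_Icc_self

variable [CompleteSpace U]

theorem StandingAssumptions.h₀_continuous (hyp : StandingAssumptions A S g₀ h₀ p ω lam) :
    Continuous h₀ := continuous_of_convexOn_of_lowerSemicontinuous hyp.h₀_convex hyp.h₀_lsc

theorem StandingAssumptions.aestronglyMeasurable_runningCost
    (hyp : StandingAssumptions A S g₀ h₀ p ω lam) (hu : MemWeightedLp p lam t u)
    (hy : IsMildState S B t x u y) :
    AEStronglyMeasurable (runningCost g₀ h₀ lam u y) (volume.restrict (Ici t)) := by
  refine AEStronglyMeasurable.mul (Continuous.aestronglyMeasurable (by fun_prop)) ?_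
  exact (hyp.g₀_continuous.comp_aestronglyMeasurable hy.aestronglyMeasurable).add
    (hyp.h₀_continuous.comp_aestronglyMeasurable hu.aestronglyMeasurable)

variable [CompleteSpace V]

theorem StandingAssumptions.runningCost_add_le (hyp : StandingAssumptions A S g₀ h₀ p ω lam)
    {τ : ℝ} (hmax : -controlAdjoint B (π τ) ∈ subdiff h₀ (u τ)) :
    runningCost g₀ h₀ lam u y τ + (Real.exp (-(lam * τ)) * (z τ - y τ) (dualGradient g₀ (y τ)) -
      Real.exp (-(lam * τ)) * B (v τ - u τ) (π τ)) ≤ runningCost g₀ h₀ lam v z τ := by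
  have h1 := fderiv_le_sub_of_convexOn hyp.g₀_mem.1 hyp.g₀_mem.2.1 (y τ) (z τ)
  rw [← apply_dualGradient] at h1
  have h2 := hmax (v τ)
  rw [inner_neg_left, real_inner_comm, inner_controlAdjoint] at h2
  rw [runningCost, runningCost, ← mul_sub, ← mul_add]
  refine mul_le_mul_of_nonneg_left ?_ (Real.exp_pos _).le
  linarith

/-- The convexity gap k integrates over (t, T] to minus the boundary term, so the comparison of
truncated costs passes to the limit. -/
theorem StandingAssumptions.cost_le_of_boundary (hyp : StandingAssumptions A S g₀ h₀ p ω lam)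
    (hu : IsAdmissible S B g₀ h₀ p lam t x u y) (hv : IsAdmissible S B g₀ h₀ p lam t x v z)
    (hπ : IsMildCostate S g₀ lam t y π)
    (hmax : ∀ᵐ τ ∂(volume.restrict (Ici t)), -controlAdjoint B (π τ) ∈ subdiff h₀ (u τ))
    {T : ℕ → ℝ} (hT : Tendsto T atTop atTop)
    (hbdry : Tendsto (fun n => Real.exp (-(lam * T n)) *
      duhamel S t (fun σ => B (v σ - u σ)) (T n) (π (T n))) atTop (𝓝 0)) :
    cost g₀ h₀ lam t u y ≤ cost g₀ h₀ lam t v z := by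
  -- If the positive part of the competitor's cost diverges, well-definedness makes that cost ⊤ and
  -- there is nothing to prove.
  by_cases hpos : (∫⁻ τ in Ici t, ENNReal.ofReal (runningCost g₀ h₀ lam v z τ)) = ⊤
  · have hneg := hv.costDefined.resolve_left (not_not.2 hpos)
    have : cost g₀ h₀ lam t v z = ⊤ := by
      rw [cost, hpos, EReal.coe_ennreal_top, EReal.top_sub (by simpa using hneg)]
    rw [this]; exact le_top
  have hsub : ∀ T, volume.restrict (Ioc t T) ≤ volume.restrict (Ici t) := fun T =>
    Measure.restrict_mono (Ioc_subset_Icc_self.trans Icc_subset_Ici_self) le_rfl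
  have hloc : ∀ {w : ℝ → U}, MemWeightedLp p lam t w → ∀ T, IntegrableOn w (Icc t T) :=
    fun hw T => hw.integrableOn_Icc hyp.one_lt_p.le T
  have hf : ∀ T, IntegrableOn (fun σ => B (v σ - u σ)) (Ioc t T) := fun T =>
    B.integrable_comp ((hloc (hv.control.sub hu.control) T).mono_set Ioc_subset_Icc_self)
  obtain ⟨C, hC, hGC⟩ := hyp.g₀_mem.exists_norm_dualGradient_le_sq
  have hG : ∀ T, IntegrableOn (fun τ => dualGradient g₀ (y τ)) (Ioc t T) :=
    hu.state.integrableOn_comp hyp.growth (hloc hu.control) hyp.g₀_mem.continuous_dualGradient hC hGC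
  set k : ℝ → ℝ := fun τ => Real.exp (-(lam * τ)) *
    duhamel S t (fun σ => B (v σ - u σ)) τ (dualGradient g₀ (y τ)) -
      Real.exp (-(lam * τ)) * B (v τ - u τ) (π τ) with hk
  have hdual : ∀ T, t ≤ T → IntegrableOn k (Ioc t T) ∧ ∫ τ in Ioc t T, k τ =
      -(Real.exp (-(lam * T)) * duhamel S t (fun σ => B (v σ - u σ)) T (π T)) := fun T hT => by
    obtain ⟨h1, h2, h3⟩ := hπ.duality hyp.semigroup hyp.growth hT (hf T) (hG T)
    exact ⟨h1.sub h2, by rw [hk, integral_sub h1 h2, h3]; ring⟩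
  have hkint : ∀ T, IntegrableOn k (Ioc t T) := fun T => by
    rcases le_total t T with h | h
    · exact (hdual T h).1
    · rw [Ioc_eq_empty (not_lt.2 h)]; exact integrableOn_empty
  have hle : ∀ᵐ τ ∂volume.restrict (Ici t),
      runningCost g₀ h₀ lam u y τ + k τ ≤ runningCost g₀ h₀ lam v z τ := by
    filter_upwards [hmax, ae_restrict_mem measurableSet_Ici] with τ hτ hτt
    have := hyp.runningCost_add_le (v := v) (y := y) (z := z) hτ
    rwa [hyp.sub_eq_duhamel hu.control hv.control hu.state hv.state hτt] at this
  have hum := hyp.aestronglyMeasurable_runningCost hu.control hu.state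
  have hvm := hyp.aestronglyMeasurable_runningCost hv.control hv.state
  have hvint : ∀ T, IntegrableOn (runningCost g₀ h₀ lam v z) (Ioc t T) := fun T => by
    have h1 : Integrable (fun τ => max (runningCost g₀ h₀ lam v z τ) 0)
        (volume.restrict (Ici t)) := integrable_max_zero hvm hpos
    refine ((h1.mono_measure (hsub T)).add
      (hyp.integrableOn_exp_mul_g₀ hv.control hv.state T)).mono' (hvm.mono_measure (hsub T))
      (ae_of_all _ fun τ => ?_)
    have h2 := hyp.neg_le_runningCost v z τ
    have h3 : 0 ≤ Real.exp (-(lam * τ)) * |g₀ (z τ)| := by positivity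
    simp only [Pi.add_apply]
    rw [Real.norm_eq_abs, abs_le]
    constructor
    · linarith [le_max_right (runningCost g₀ h₀ lam v z τ) 0]
    · linarith [le_max_left (runningCost g₀ h₀ lam v z τ) 0]
  -- Local integrability for the candidate is inherited from the competitor: its running cost is at
  -- most the competitor's minus k, and at least -e^{-λτ}|g₀(y)|.
  have huint : ∀ T, IntegrableOn (runningCost g₀ h₀ lam u y) (Ioc t T) := fun T => by
    refine (((hvint T).abs.add (hkint T).abs).add
      (hyp.integrableOn_exp_mul_g₀ hu.control hu.state T)).mono' (hum.mono_measure (hsub T)) ?_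
    filter_upwards [ae_mono (hsub T) hle] with τ hτ
    have h2 := hyp.neg_le_runningCost u y τ
    have h3 : 0 ≤ Real.exp (-(lam * τ)) * |g₀ (y τ)| := by positivity
    simp only [Pi.add_apply]
    rw [Real.norm_eq_abs, abs_le]
    constructor
    · linarith [abs_nonneg (runningCost g₀ h₀ lam v z τ), abs_nonneg (k τ)]
    · linarith [le_abs_self (runningCost g₀ h₀ lam v z τ), neg_abs_le (k τ)]
  refine ereal_cost_le_of_add_le huint hvint hkint hum.aemeasurable hvm.aemeasurable
    hu.costDefined hv.costDefined hle hT ?_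
  rw [← neg_zero]
  refine hbdry.neg.congr' ?_
  filter_upwards [hT.eventually_ge_atTop t] with n hn using (hdual _ hn).2.symm

theorem StandingAssumptions.isOptimal_of_solvesOptimalitySystem
    (hyp : StandingAssumptions A S g₀ h₀ p ω lam) (hp : 2 ≤ p) {q : ℝ}
    (hpq : p.HolderConjugate q) (hω : 2 * ω < lam)
    (hu : IsAdmissible S B g₀ h₀ p lam t x u y) (hπq : MemWeightedLp q lam t π)
    (hsol : SolvesOptimalitySystem S B g₀ h₀ ω lam t x u y π) :
    IsOptimal S B g₀ h₀ p lam t x u y := by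
  refine ⟨hu, fun v z hv => ?_⟩
  have hf : MemWeightedLp p lam t fun σ => B (v σ - u σ) := (hv.control.sub hu.control).comp_clm B
  -- For λ ≤ 0 the discounted measure is infinite and L^p_λ need not lie in L²_λ. There λ ≤ λ/p, so
  -- ω < λ gives ω < λ/p and the pairing of L^p_λ with L^q_λ is used instead.
  rcases lt_or_ge 0 lam with hlam | hlam
  · have hy := hu.state.memWeightedLp_two hyp.semigroup hyp.growth hω
      (hu.control.mono_exponent hlam two_pos hp)
    refine hyp.cost_le_of_boundary hu hv hsol.costate hsol.maximum tendsto_natCast_atTop_atTop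
      ((hsol.costate.tendsto_duhamel_apply hyp.growth hω (hf.mono_exponent hlam two_pos hp)
        (hyp.g₀_mem.memWeightedLp_dualGradient hlam two_pos hy)).comp tendsto_natCast_atTop_atTop)
  · have hωp : ω < lam / p := by
      have := hyp.ω_lt
      refine this.trans_le ?_
      rw [le_div_iff₀ (by linarith)]
      nlinarith
    obtain ⟨T, hT, hbdry⟩ := exists_seq_tendsto_duhamel_apply hyp.growth hpq hωp hf hπq
    exact hyp.cost_le_of_boundary hu hv hsol.costate hsol.maximum hT hbdry

end Sufficiency

/-! ### Existence, integrability and transversality of the costate -/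

theorem integrable_apply_of_memLp_two {V : Type*} [NormedAddCommGroup V] [InnerProductSpace ℝ V]
    {α : Type*} [MeasurableSpace α] {μ : Measure α}
    {φ : α → StrongDual ℝ V} {v : α → V} (hφ : MemLp φ 2 μ) (hv : MemLp v 2 μ) :
    Integrable (fun a => φ a (v a)) μ :=
  (hφ.norm.integrable_mul hv.norm).mono' (aestronglyMeasurable_apply hφ.1 hv.1)
    (ae_of_all _ fun a => (φ a).le_opNorm (v a))

theorem memWeightedLp_two_iff {X : Type*} [NormedAddCommGroup X] [NormedSpace ℝ X]
    {lam t : ℝ} {f : ℝ → X} :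
    MemWeightedLp 2 lam t f ↔ MemLp f 2 (discount lam t) := by
  rw [memWeightedLp_iff two_pos, ENNReal.ofReal_ofNat]

section CostateExistence

variable {V : Type*} [NormedAddCommGroup V] [InnerProductSpace ℝ V] [CompleteSpace V]
variable {S : ℝ → StrongDual ℝ V →L[ℝ] StrongDual ℝ V} {ω lam t : ℝ}
  {g₀ : StrongDual ℝ V → ℝ} {y : ℝ → StrongDual ℝ V} {π : ℝ → V}

/-- The costate associated with the trajectory `y`. -/
def costate (S : ℝ → StrongDual ℝ V →L[ℝ] StrongDual ℝ V) (g₀ : StrongDual ℝ V → ℝ) (lam : ℝ)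
    (y : ℝ → StrongDual ℝ V) (τ : ℝ) : V :=
  ∫ σ in Ioi τ, Real.exp (-(lam * (σ - τ))) •
    dualityAdjoint (S (σ - τ)) (dualGradient g₀ (y σ))

theorem isMildCostate_costate [TopologicalSpace.SeparableSpace V] (hS : IsC0Semigroup S)
    (hg : ∀ τ : ℝ, 0 ≤ τ → ∀ x, ‖S τ x‖ ≤ Real.exp (ω * τ) * ‖x‖) (hω : 2 * ω < lam)
    (hG : MemWeightedLp 2 lam t fun τ => dualGradient g₀ (y τ)) :
    IsMildCostate S g₀ lam t y (costate S g₀ lam y) := by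
  refine fun τ hτ => ⟨?_, rfl⟩
  have hsub : volume.restrict (Ioi τ) ≤ volume.restrict (Ici t) :=
    Measure.restrict_mono (fun σ hσ => hτ.trans (mem_Ioi.1 hσ).le) le_rfl
  have hm : AEStronglyMeasurable (fun σ => Real.exp (-(lam * (σ - τ))) •
      dualityAdjoint (S (σ - τ)) (dualGradient g₀ (y σ))) (volume.restrict (Ioi τ)) := by
    refine aestronglyMeasurable_of_forall_dual fun φ => ?_
    have h1 : AEStronglyMeasurable (fun σ => Real.exp (-(lam * (σ - τ))) *
        S (max (σ - τ) 0) φ (dualGradient g₀ (y σ))) (volume.restrict (Ioi τ)) :=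
      AEStronglyMeasurable.mul (Continuous.aestronglyMeasurable (by fun_prop))
        (aestronglyMeasurable_apply (hS.aestronglyMeasurable_comp hg
          (Continuous.aestronglyMeasurable (by fun_prop)) aestronglyMeasurable_const)
          (hG.aestronglyMeasurable.mono_measure hsub))
    refine h1.congr ((ae_restrict_iff' measurableSet_Ioi).2 (ae_of_all _ fun σ hσ => ?_))
    simp only
    rw [map_smul, apply_dualityAdjoint, smul_eq_mul,
      max_eq_left (sub_nonneg.2 (mem_Ioi.1 hσ).le)]
  -- The factor e^{-λτ/2} is constant in σ; it is inserted to match the convolution bound and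
  -- cancelled afterwards.
  have h2 : Integrable (fun σ => Real.exp (-(lam * τ / 2)) • Real.exp (-(lam * (σ - τ))) •
      dualityAdjoint (S (σ - τ)) (dualGradient g₀ (y σ))) (volume.restrict (Ioi τ)) :=
    ⟨hm.const_smul _, (lintegral_enorm_costate_le hg 2 hτ _).trans_lt
      (lt_top_iff_ne_top.2 (expConv_ne_top (by linarith) one_le_two hG.aemeasurable_weightedNorm
        (hG.lintegral_weightedNorm_ne_top two_pos) τ))⟩
  exact (integrable_smul_iff (Real.exp_pos _).ne' _).1 h2

theorem IsMildCostate.aestronglyMeasurable [TopologicalSpace.SeparableSpace V]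
    (hS : IsC0Semigroup S)
    (hg : ∀ τ : ℝ, 0 ≤ τ → ∀ x, ‖S τ x‖ ≤ Real.exp (ω * τ) * ‖x‖)
    (hπ : IsMildCostate S g₀ lam t y π)
    (hG : AEStronglyMeasurable (fun τ => dualGradient g₀ (y τ)) (volume.restrict (Ici t))) :
    AEStronglyMeasurable π (volume.restrict (Ici t)) := by
  refine aestronglyMeasurable_of_forall_dual fun φ => ?_
  have h1 : AEStronglyMeasurable ({z : ℝ × ℝ | z.1 < z.2}.indicator fun z =>
      Real.exp (-(lam * (z.2 - z.1))) * S (max (z.2 - z.1) 0) φ (dualGradient g₀ (y z.2)))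
      ((volume.restrict (Ici t)).prod (volume.restrict (Ici t))) := by
    refine AEStronglyMeasurable.indicator ?_ (measurableSet_lt measurable_fst measurable_snd)
    exact AEStronglyMeasurable.mul (Continuous.aestronglyMeasurable (by fun_prop))
        (aestronglyMeasurable_apply (hS.aestronglyMeasurable_comp hg
          (Continuous.aestronglyMeasurable (by fun_prop)) aestronglyMeasurable_const)
          hG.comp_snd)
  refine h1.integral_prod_right'.congr
    ((ae_restrict_iff' measurableSet_Ici).2 (ae_of_all _ fun τ hτ => ?_))
  refine Eq.trans ?_ (hπ.apply hτ φ).2.symm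
  have h2 : ∀ σ, {z : ℝ × ℝ | z.1 < z.2}.indicator (fun z =>
      Real.exp (-(lam * (z.2 - z.1))) * S (max (z.2 - z.1) 0) φ (dualGradient g₀ (y z.2))) (τ, σ) =
      (Ioi τ).indicator (fun σ => Real.exp (-(lam * (σ - τ))) *
        S (max (σ - τ) 0) φ (dualGradient g₀ (y σ))) σ := fun σ => by
    simp [indicator_apply]
  simp only [h2]
  have h3 : Ici t ∩ Ioi τ = Ioi τ :=
    inter_eq_right.2 fun σ hσ => (mem_Ici.1 hτ).trans (mem_Ioi.1 hσ).le
  rw [setIntegral_indicator measurableSet_Ioi, h3]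
  refine setIntegral_congr_fun measurableSet_Ioi fun σ hσ => ?_
  simp only [max_eq_left (sub_nonneg.2 (mem_Ioi.1 hσ).le)]

theorem IsMildCostate.memWeightedLp_two [TopologicalSpace.SeparableSpace V]
    (hS : IsC0Semigroup S)
    (hg : ∀ τ : ℝ, 0 ≤ τ → ∀ x, ‖S τ x‖ ≤ Real.exp (ω * τ) * ‖x‖) (hω : 2 * ω < lam)
    (hπ : IsMildCostate S g₀ lam t y π)
    (hG : MemWeightedLp 2 lam t fun τ => dualGradient g₀ (y τ)) : MemWeightedLp 2 lam t π := by
  refine memWeightedLp_of_le_expConv one_le_two (c := lam - lam / 2 - ω) (by linarith) hG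
    (hπ.aestronglyMeasurable hS hg hG.aestronglyMeasurable) fun τ hτ => ?_
  rw [(hπ τ hτ).2]
  exact enorm_exp_smul_costate_le hg 2 hτ _

/-- Since ω - λ = (ω - λ/2) - λ/2, the weight is a decaying exponential times the one under which π
already tends to zero. -/
theorem IsMildCostate.transversality
    (hg : ∀ τ : ℝ, 0 ≤ τ → ∀ x, ‖S τ x‖ ≤ Real.exp (ω * τ) * ‖x‖) (hω : 2 * ω < lam)
    (hπ : IsMildCostate S g₀ lam t y π)
    (hG : MemWeightedLp 2 lam t fun τ => dualGradient g₀ (y τ)) :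
    Tendsto (fun T : ℝ => Real.exp ((ω - lam) * T) • π T) atTop (𝓝 0) := by
  have h1 : Tendsto (fun T : ℝ => Real.exp ((ω - lam / 2) * T)) atTop (𝓝 0) :=
    Real.tendsto_exp_atBot.comp (tendsto_id.const_mul_atTop_of_neg (by linarith))
  have h2 := h1.smul (hπ.tendsto_exp_smul hg hω hG)
  rw [zero_smul] at h2
  refine h2.congr fun T => ?_
  rw [smul_smul, ← Real.exp_add]
  congr 2; ring

/-- Duality between the state and the costate on `[t, +∞)`. -/
theorem IsMildCostate.duality_discount [TopologicalSpace.SeparableSpace V]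
    (hS : IsC0Semigroup S)
    (hg : ∀ τ : ℝ, 0 ≤ τ → ∀ x, ‖S τ x‖ ≤ Real.exp (ω * τ) * ‖x‖) (hω : 2 * ω < lam)
    (hπ : IsMildCostate S g₀ lam t y π)
    (hG : MemWeightedLp 2 lam t fun τ => dualGradient g₀ (y τ)) {f : ℝ → StrongDual ℝ V}
    (hf : MemWeightedLp 2 lam t f) :
    Integrable (fun τ => duhamel S t f τ (dualGradient g₀ (y τ))) (discount lam t) ∧
    Integrable (fun τ => f τ (π τ)) (discount lam t) ∧
    ∫ τ, duhamel S t f τ (dualGradient g₀ (y τ)) ∂discount lam t =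
      ∫ τ, f τ (π τ) ∂discount lam t := by
  have h1 := integrable_apply_of_memLp_two (memWeightedLp_two_iff.1
    (hS.memWeightedLp_duhamel hg one_le_two (by linarith) hf)) (memWeightedLp_two_iff.1 hG)
  have h2 := integrable_apply_of_memLp_two (memWeightedLp_two_iff.1 hf)
    (memWeightedLp_two_iff.1 (hπ.memWeightedLp_two hS hg hω hG))
  refine ⟨h1, h2, ?_⟩
  rw [integrable_discount, integrableOn_Ici_iff_integrableOn_Ioi] at h1 h2
  rw [integral_discount, integral_discount, integral_Ici_eq_integral_Ioi,
    integral_Ici_eq_integral_Ioi]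
  have h3 := intervalIntegral_tendsto_integral_Ioi t h1 tendsto_id
  have h4 := (intervalIntegral_tendsto_integral_Ioi t h2 tendsto_id).sub
    (hπ.tendsto_duhamel_apply hg hω hf hG)
  rw [sub_zero] at h4
  refine tendsto_nhds_unique (h3.congr' ?_) h4
  filter_upwards [eventually_ge_atTop t] with T hT
  rw [id, intervalIntegral.integral_of_le hT, intervalIntegral.integral_of_le hT]
  exact (hπ.duality hS hg hT
    ((hf.integrableOn_Icc one_le_two T).mono_set Ioc_subset_Icc_self)
    ((hG.integrableOn_Icc one_le_two T).mono_set Ioc_subset_Icc_self)).2.2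

end CostateExistence

/-! ### Necessity: variations of an optimal control -/

theorem lintegral_ofReal_ne_top_and_sub_eq_integral {t : ℝ} {f : ℝ → ℝ}
    (hf : IntegrableOn f (Ici t)) :
    ((∫⁻ τ in Ici t, ENNReal.ofReal (f τ)) ≠ ⊤) ∧
    ((∫⁻ τ in Ici t, ENNReal.ofReal (f τ) : ℝ≥0∞) : EReal) -
        ((∫⁻ τ in Ici t, ENNReal.ofReal (-f τ) : ℝ≥0∞) : EReal) =
      ((∫ τ in Ici t, f τ : ℝ) : EReal) := by
  have h1 : (∫⁻ τ in Ici t, ENNReal.ofReal (f τ)) ≠ ⊤ := hf.lintegral_lt_top.ne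
  have h2 : (∫⁻ τ in Ici t, ENNReal.ofReal (-f τ)) ≠ ⊤ := hf.neg.lintegral_lt_top.ne
  refine ⟨h1, ?_⟩
  rw [integral_eq_lintegral_pos_part_sub_lintegral_neg_part hf, EReal.coe_sub,
    EReal.coe_ennreal_toReal h1, EReal.coe_ennreal_toReal h2]

theorem locallyIntegrableOn_Ici_of_forall_Icc {X : Type*} [NormedAddCommGroup X] {t : ℝ}
    {f : ℝ → X} (hf : ∀ T, IntegrableOn f (Icc t T)) : LocallyIntegrableOn f (Ici t) := by
  intro τ _
  refine ⟨Icc t (τ + 1), ?_, hf _⟩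
  rw [← Ici_inter_Iic]
  exact inter_mem self_mem_nhdsWithin (mem_nhdsWithin_of_mem_nhds (Iic_mem_nhds (lt_add_one τ)))

theorem nonneg_of_forall_smul_add {a b : ℝ} (hb : 0 ≤ b)
    (h : ∀ θ : ℝ, 0 < θ → θ ≤ 1 → 0 ≤ θ * a + θ ^ 2 * b) : 0 ≤ a := by
  by_contra! ha
  have h1 : 0 < -a + b := by linarith
  -- At this θ, which lies in (0, 1] because b ≥ 0 > a, the expression equals a³/(b - a)² < 0.
  have h2 := h (-a / (-a + b)) (div_pos (by linarith) h1) ((div_le_one h1).2 (by linarith))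
  have h3 : -a / (-a + b) * a + (-a / (-a + b)) ^ 2 * b = -(a ^ 2 * -a) / (-a + b) ^ 2 := by
    field_simp; ring
  rw [h3] at h2
  have h4 : -(a ^ 2 * -a) / (-a + b) ^ 2 < 0 :=
    div_neg_of_neg_of_pos (by have := mul_pos (pow_pos (neg_pos.2 ha) 2) (neg_pos.2 ha); nlinarith)
      (by positivity)
  linarith

section Necessity

variable {V : Type*} [NormedAddCommGroup V] [InnerProductSpace ℝ V]
variable {U : Type*} [NormedAddCommGroup U] [InnerProductSpace ℝ U]
variable {A : StrongDual ℝ V →ₗ.[ℝ] StrongDual ℝ V} {S : ℝ → StrongDual ℝ V →L[ℝ] StrongDual ℝ V}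
  {B : U →L[ℝ] StrongDual ℝ V} {g₀ : StrongDual ℝ V → ℝ} {h₀ : U → ℝ} {p ω lam t : ℝ}
  {x : StrongDual ℝ V} {u v : ℝ → U} {y z : ℝ → StrongDual ℝ V} {π : ℝ → V}

theorem duhamel_const_smul {X : Type*} [NormedAddCommGroup X] [NormedSpace ℝ X]
    (S : ℝ → X →L[ℝ] X) (c : ℝ) (f : ℝ → X) (τ : ℝ) :
    duhamel S t (fun σ => c • f σ) τ = c • duhamel S t f τ := by
  simp only [duhamel, map_smul, intervalIntegral.integral_smul]

theorem StandingAssumptions.isMildState (hyp : StandingAssumptions A S g₀ h₀ p ω lam)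
    (hp : 2 ≤ p) (hω : 2 * ω < lam) (hlam : 0 < lam) (hu : MemWeightedLp p lam t u)
    (x : StrongDual ℝ V) :
    IsMildState S B t x u
      (fun τ => S (max (τ - t) 0) x + duhamel S t (fun σ => B (u σ)) τ) := by
  have h := (hyp.semigroup.memWeightedLp_two_orbit hyp.growth hω x (t := t)).add
    (hyp.semigroup.memWeightedLp_duhamel hyp.growth one_le_two (by linarith)
      ((hu.mono_exponent hlam two_pos hp).comp_clm B))
  refine ⟨locallyIntegrableOn_Ici_of_forall_Icc fun T => h.integrableOn_Icc one_le_two T,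
    fun τ hτ => ?_⟩
  simp only [max_eq_left (sub_nonneg.2 hτ)]; rfl

theorem IsMildState.memWeightedLp_two' (hyp : StandingAssumptions A S g₀ h₀ p ω lam)
    (hp : 2 ≤ p) (hω : 2 * ω < lam) (hlam : 0 < lam) (hu : MemWeightedLp p lam t u)
    (hy : IsMildState S B t x u y) : MemWeightedLp 2 lam t y :=
  hy.memWeightedLp_two hyp.semigroup hyp.growth hω (hu.mono_exponent hlam two_pos hp)

theorem StandingAssumptions.integrable_g₀ (hyp : StandingAssumptions A S g₀ h₀ p ω lam)
    (hlam : 0 < lam) (hy : MemWeightedLp 2 lam t y) :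
    Integrable (fun τ => g₀ (y τ)) (discount lam t) := by
  have := isFiniteMeasure_discount hlam t
  obtain ⟨C, hC, hgC⟩ := hyp.g₀_mem.abs_le_quadratic
  rw [memWeightedLp_two_iff] at hy
  have h1 : Integrable (fun τ => ‖y τ‖ ^ 2) (discount lam t) :=
    (memLp_two_iff_integrable_sq_norm hy.1).1 hy
  exact (((integrable_const (1 : ℝ)).add h1).const_mul C).mono'
    (hyp.g₀_continuous.comp_aestronglyMeasurable hy.1) (ae_of_all _ fun τ => hgC (y τ))

theorem integrableOn_runningCost_iff {U : Type*} {h₀ : U → ℝ} {u : ℝ → U} :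
    IntegrableOn (runningCost g₀ h₀ lam u y) (Ici t) ↔
      Integrable (fun τ => g₀ (y τ) + h₀ (u τ)) (discount lam t) :=
  integrable_discount.symm

theorem cost_eq_integral {U : Type*} {h₀ : U → ℝ} {u : ℝ → U}
    (h : Integrable (fun τ => g₀ (y τ) + h₀ (u τ)) (discount lam t)) :
    cost g₀ h₀ lam t u y = ((∫ τ, (g₀ (y τ) + h₀ (u τ)) ∂discount lam t : ℝ) : EReal) := by
  rw [integral_discount]
  exact (lintegral_ofReal_ne_top_and_sub_eq_integral (integrableOn_runningCost_iff.2 h)).2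

theorem StandingAssumptions.isAdmissible (hyp : StandingAssumptions A S g₀ h₀ p ω lam)
    (hp : 2 ≤ p) (hω : 2 * ω < lam) (hlam : 0 < lam) (hu : MemWeightedLp p lam t u)
    (hy : IsMildState S B t x u y) (hh : Integrable (fun τ => h₀ (u τ)) (discount lam t)) :
    IsAdmissible S B g₀ h₀ p lam t x u y := by
  refine ⟨hu, hy, Or.inl ?_⟩
  exact (lintegral_ofReal_ne_top_and_sub_eq_integral (integrableOn_runningCost_iff.2
    ((hyp.integrable_g₀ hlam (hy.memWeightedLp_two' hyp hp hω hlam hu)).add hh))).1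

variable [CompleteSpace U]

/-- Comparison with the zero control, whose cost is finite for λ > 0, bounds the optimal cost above.
Since g₀(y) is integrable and h₀ ≥ 0, the control part is integrable as well. -/
theorem StandingAssumptions.integrable_h₀_of_isOptimal
    (hyp : StandingAssumptions A S g₀ h₀ p ω lam) (hp : 2 ≤ p) (hω : 2 * ω < lam)
    (hlam : 0 < lam) (hu : IsOptimal S B g₀ h₀ p lam t x u y) :
    Integrable (fun τ => h₀ (u τ)) (discount lam t) := by
  have := isFiniteMeasure_discount hlam t
  have hp0 : 0 < p := by linarith
  have h0 : MemWeightedLp p lam t fun _ => (0 : U) := memWeightedLp_const hlam hp0 0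
  have hy0 := hyp.isMildState (B := B) hp hω hlam h0 x
  have hh0 : Integrable (fun _ : ℝ => h₀ (0 : U)) (discount lam t) := integrable_const _
  have hle := hu.2 _ _ (hyp.isAdmissible hp hω hlam h0 hy0 hh0)
  rw [cost_eq_integral (u := fun _ => (0 : U))
    ((hyp.integrable_g₀ hlam (hy0.memWeightedLp_two' hyp hp hω hlam h0)).add hh0)] at hle
  have hpos : (∫⁻ τ in Ici t, ENNReal.ofReal (runningCost g₀ h₀ lam u y τ)) ≠ ⊤ := by
    intro htop
    have hneg := hu.1.costDefined.resolve_left (not_not.2 htop)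
    rw [cost, htop, EReal.coe_ennreal_top, EReal.top_sub (by simpa using hneg), top_le_iff] at hle
    exact EReal.coe_ne_top _ hle
  have h1 := integrable_max_zero
    (hyp.aestronglyMeasurable_runningCost hu.1.control hu.1.state) hpos
  have h2 : IntegrableOn (fun τ => Real.exp (-(lam * τ)) • g₀ (y τ)) (Ici t) :=
    integrable_discount.1
      (hyp.integrable_g₀ hlam (hu.1.state.memWeightedLp_two' hyp hp hω hlam hu.1.control))
  rw [integrable_discount]
  refine (h1.add h2.abs).mono' ((aestronglyMeasurable_exp_smul (by fun_prop)).2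
    (hyp.h₀_continuous.comp_aestronglyMeasurable hu.1.control.aestronglyMeasurable))
    (ae_of_all _ fun τ => ?_)
  have h3 := le_max_left (runningCost g₀ h₀ lam u y τ) 0
  have h4 := neg_abs_le (Real.exp (-(lam * τ)) * g₀ (y τ))
  simp only [Pi.add_apply, smul_eq_mul]
  rw [Real.norm_of_nonneg (mul_nonneg (Real.exp_pos _).le (hyp.h₀_nonneg _))]
  have h5 : runningCost g₀ h₀ lam u y τ =
    Real.exp (-(lam * τ)) * g₀ (y τ) + Real.exp (-(lam * τ)) * h₀ (u τ) := mul_add _ _ _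
  linarith

variable [CompleteSpace V]

/-- First variation of the cost at an optimal pair. -/
theorem StandingAssumptions.integral_variation_nonneg
    (hyp : StandingAssumptions A S g₀ h₀ p ω lam) (hp : 2 ≤ p) (hω : 2 * ω < lam)
    (hlam : 0 < lam) (hu : IsOptimal S B g₀ h₀ p lam t x u y) (hv : MemWeightedLp p lam t v)
    (hhv : Integrable (fun τ => h₀ (v τ)) (discount lam t)) :
    0 ≤ ∫ τ, (duhamel S t (fun σ => B (v σ - u σ)) τ (dualGradient g₀ (y τ)) +
      (h₀ (v τ) - h₀ (u τ))) ∂discount lam t := by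
  obtain ⟨K, hK0, hK⟩ := hyp.g₀_mem.sub_le
  set ζ := duhamel S t (fun σ => B (v σ - u σ)) with hζ
  have hhu := hyp.integrable_h₀_of_isOptimal hp hω hlam hu
  have hy := hu.1.state.memWeightedLp_two' hyp hp hω hlam hu.1.control
  have hG := hyp.g₀_mem.memWeightedLp_dualGradient hlam two_pos hy
  have hw : MemWeightedLp p lam t fun σ => v σ - u σ := hv.sub hu.1.control
  have hζ2 : MemWeightedLp 2 lam t ζ :=
    hyp.semigroup.memWeightedLp_duhamel hyp.growth one_le_two (by linarith)
      ((hw.mono_exponent hlam two_pos hp).comp_clm B)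
  have hζG := integrable_apply_of_memLp_two (memWeightedLp_two_iff.1 hζ2)
    (memWeightedLp_two_iff.1 hG)
  have hζsq : Integrable (fun τ => ‖ζ τ‖ ^ 2) (discount lam t) :=
    (memLp_two_iff_integrable_sq_norm (memWeightedLp_two_iff.1 hζ2).1).1
      (memWeightedLp_two_iff.1 hζ2)
  have hvar : Integrable (fun τ => ζ τ (dualGradient g₀ (y τ)) + (h₀ (v τ) - h₀ (u τ)))
      (discount lam t) := hζG.add (hhv.sub hhu)
  refine nonneg_of_forall_smul_add (b := K * ∫ τ, ‖ζ τ‖ ^ 2 ∂discount lam t)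
    (mul_nonneg hK0 (integral_nonneg fun τ => by positivity)) fun θ hθ0 hθ1 => ?_
  set uθ : ℝ → U := fun σ => u σ + θ • (v σ - u σ) with huθ
  have huθp : MemWeightedLp p lam t uθ := hu.1.control.add (hw.const_smul θ)
  have hconv : ∀ τ, h₀ (uθ τ) ≤ h₀ (u τ) + θ * (h₀ (v τ) - h₀ (u τ)) := fun τ => by
    have h1 := hyp.h₀_convex.2 (mem_univ (u τ)) (mem_univ (v τ)) (sub_nonneg.2 hθ1) hθ0.le
      (by ring)
    rw [smul_eq_mul, smul_eq_mul] at h1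
    have h2 : (1 - θ) • u τ + θ • v τ = uθ τ := by
      rw [huθ, sub_smul, one_smul]; simp only [smul_sub]; abel
    rw [h2] at h1
    linarith
  -- Convexity bounds `h₀` along the segment from above by an integrable function, and zero bounds
  -- it from below, so the perturbed pair is admissible.
  have hhθ : Integrable (fun τ => h₀ (uθ τ)) (discount lam t) := by
    refine (hhu.add ((hhv.sub hhu).const_mul θ)).mono' (hyp.h₀_continuous.comp_aestronglyMeasurable
      (aestronglyMeasurable_discount.2 huθp.aestronglyMeasurable)) (ae_of_all _ fun τ => ?_)
    rw [Real.norm_of_nonneg (hyp.h₀_nonneg _)]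
    exact hconv τ
  have hyθ := hyp.isMildState (B := B) hp hω hlam huθp x
  set yθ : ℝ → StrongDual ℝ V :=
    fun τ => S (max (τ - t) 0) x + duhamel S t (fun σ => B (uθ σ)) τ
  have hgθ := hyp.integrable_g₀ hlam (hyθ.memWeightedLp_two' hyp hp hω hlam huθp)
  have hgy := hyp.integrable_g₀ hlam hy
  have hle := hu.2 _ _ (hyp.isAdmissible hp hω hlam huθp hyθ hhθ)
  rw [cost_eq_integral (u := u) (hgy.add hhu), cost_eq_integral (u := uθ) (hgθ.add hhθ), EReal.coe_le_coe_iff] at hle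
  have hdiff : ∀ τ, t ≤ τ → yθ τ - y τ = θ • ζ τ := fun τ hτ => by
    rw [hyp.sub_eq_duhamel hu.1.control huθp hu.1.state hyθ hτ, hζ, ← duhamel_const_smul]
    simp only [huθ, add_sub_cancel_left, map_smul]
  -- The trajectory moves by exactly θζ, so the quadratic bound for `g₀` leaves an error of order
  -- θ², which disappears in `nonneg_of_forall_smul_add`.
  have hub : ∫ τ, (g₀ (yθ τ) + h₀ (uθ τ)) ∂discount lam t ≤
      ∫ τ, ((g₀ (y τ) + h₀ (u τ)) + (θ * (ζ τ (dualGradient g₀ (y τ)) + (h₀ (v τ) - h₀ (u τ))) +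
        θ ^ 2 * (K * ‖ζ τ‖ ^ 2))) ∂discount lam t := by
    refine integral_mono_ae (hgθ.add hhθ) ((hgy.add hhu).add ((hvar.const_mul θ).add
      ((hζsq.const_mul K).const_mul (θ ^ 2)))) (ae_discount.2 ?_)
    filter_upwards [ae_restrict_mem measurableSet_Ici] with τ hτ
    have h1 := hK (y τ) (yθ τ)
    rw [← apply_dualGradient, hdiff τ hτ, norm_smul, mul_pow, Real.norm_eq_abs, sq_abs,
      smul_apply, smul_eq_mul] at h1
    have h2 := hconv τ
    linarith
  have hcu : Integrable (fun τ => g₀ (y τ) + h₀ (u τ)) (discount lam t) := hgy.add hhu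
  have hpert : Integrable (fun τ => θ * (ζ τ (dualGradient g₀ (y τ)) + (h₀ (v τ) - h₀ (u τ))) +
      θ ^ 2 * (K * ‖ζ τ‖ ^ 2)) (discount lam t) :=
    (hvar.const_mul θ).add ((hζsq.const_mul K).const_mul (θ ^ 2))
  rw [integral_add hcu hpert,
    integral_add (hvar.const_mul θ) ((hζsq.const_mul K).const_mul (θ ^ 2)), integral_const_mul,
    integral_const_mul, integral_const_mul] at hub
  linarith

theorem StandingAssumptions.maximum_of_isOptimal [TopologicalSpace.SeparableSpace V]
    [TopologicalSpace.SeparableSpace U]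
    (hyp : StandingAssumptions A S g₀ h₀ p ω lam) (hp : 2 ≤ p) (hω : 2 * ω < lam)
    (hlam : 0 < lam) (hu : IsOptimal S B g₀ h₀ p lam t x u y)
    (hπ : IsMildCostate S g₀ lam t y π) :
    ∀ᵐ τ ∂(volume.restrict (Ici t)), -controlAdjoint B (π τ) ∈ subdiff h₀ (u τ) := by
  classical
  have := isFiniteMeasure_discount hlam t
  have hp0 : 0 < p := by linarith
  have hhu := hyp.integrable_h₀_of_isOptimal hp hω hlam hu
  have hG := hyp.g₀_mem.memWeightedLp_dualGradient hlam two_pos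
    (hu.1.state.memWeightedLp_two' hyp hp hω hlam hu.1.control)
  have hB : ∀ {w : ℝ → U}, MemWeightedLp p lam t w →
      MemWeightedLp 2 lam t fun σ => B (w σ - u σ) := fun hw =>
    ((hw.sub hu.1.control).mono_exponent hlam two_pos hp).comp_clm B
  have hconst : ∀ c : U, ∀ᵐ τ ∂discount lam t, 0 ≤ B (c - u τ) (π τ) + (h₀ c - h₀ (u τ)) := by
    intro c
    have hc : MemWeightedLp p lam t fun _ => c := memWeightedLp_const hlam hp0 c
    have hi : Integrable (fun τ => B (c - u τ) (π τ)) (discount lam t) :=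
      (hπ.duality_discount hyp.semigroup hyp.growth hω hG (hB hc)).2.1
    have hhc : Integrable (fun τ => h₀ c - h₀ (u τ)) (discount lam t) :=
      (integrable_const _).sub hhu
    refine ae_nonneg_of_forall_setIntegral_nonneg (hi.add hhc) fun E hE _ => ?_
    -- The variation replaces u by the constant c on E only. Outside E the dualised integrand
    -- vanishes, so the first variation becomes an integral over the arbitrary set E.
    set v : ℝ → U := E.piecewise (fun _ => c) u with hv
    have hvp : MemWeightedLp p lam t v := by
      rw [memWeightedLp_iff hp0] at hc ⊢
      exact (hc.restrict E).piecewise hE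
        (((memWeightedLp_iff hp0).1 hu.1.control).restrict Eᶜ)
    have hhv : Integrable (fun τ => h₀ (v τ)) (discount lam t) := by
      have h1 : (fun τ => h₀ (v τ)) = E.piecewise (fun _ => h₀ c) fun τ => h₀ (u τ) := by
        ext τ; by_cases hτ : τ ∈ E <;> simp [hv, hτ]
      rw [h1]
      exact Integrable.piecewise hE (integrable_const _).integrableOn hhu.integrableOn
    have h2 := hyp.integral_variation_nonneg hp hω hlam hu hvp hhv
    obtain ⟨h3, h4, h5⟩ := hπ.duality_discount hyp.semigroup hyp.growth hω hG (hB hvp)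
    have h6 : Integrable (fun τ => h₀ (v τ) - h₀ (u τ)) (discount lam t) := hhv.sub hhu
    rw [integral_add h3 h6, h5, ← integral_add h4 h6] at h2
    rw [← integral_indicator hE]
    refine h2.trans_eq (integral_congr_ae (ae_of_all _ fun τ => ?_))
    by_cases hτ : τ ∈ E <;> simp [hv, hτ]
  -- The exceptional null set depends on c; a countable dense family of constants gives a common
  -- one, and continuity of `h₀` extends the inequality to all c.
  have hae := ae_discount.1 (ae_all_iff.2 fun n => hconst (TopologicalSpace.denseSeq U n))
  filter_upwards [hae] with τ hτ c
  have hcont : Continuous fun c => B (c - u τ) (π τ) + (h₀ c - h₀ (u τ)) := by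
    have h1 : Continuous fun c => B (c - u τ) (π τ) := by
      have h2 : Continuous fun c => B.flip (π τ) (c - u τ) := by fun_prop
      exact h2
    exact h1.add (hyp.h₀_continuous.sub continuous_const)
  have h2 : 0 ≤ B (c - u τ) (π τ) + (h₀ c - h₀ (u τ)) :=
    (TopologicalSpace.denseRange_denseSeq U).induction_on
      (p := fun c => 0 ≤ B (c - u τ) (π τ) + (h₀ c - h₀ (u τ))) c
      (isClosed_le continuous_const hcont) hτ
  rw [inner_neg_left, real_inner_comm, inner_controlAdjoint]
  linarith

theorem StandingAssumptions.exists_costate_of_isOptimal [TopologicalSpace.SeparableSpace V]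
    [TopologicalSpace.SeparableSpace U]
    (hyp : StandingAssumptions A S g₀ h₀ p ω lam) (hp : 2 ≤ p) {q : ℝ}
    (hpq : p.HolderConjugate q) (hω : 2 * ω < lam)
    (hlam : 0 < lam) (hu : IsOptimal S B g₀ h₀ p lam t x u y) :
    ∃ π : ℝ → V, MemWeightedLp q lam t π ∧
      SolvesOptimalitySystem S B g₀ h₀ ω lam t x u y π := by
  have hG := hyp.g₀_mem.memWeightedLp_dualGradient hlam two_pos
    (hu.1.state.memWeightedLp_two' hyp hp hω hlam hu.1.control)
  have hπ := isMildCostate_costate hyp.semigroup hyp.growth hω hG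
  -- For p ≥ 2 the conjugate exponent is at most 2, so the L² bound on the costate yields the L^q
  -- one.
  have hq : q ≤ 2 := by
    rw [hpq.conjugate_eq, div_le_iff₀ (by linarith)]
    linarith
  exact ⟨_, (hπ.memWeightedLp_two hyp.semigroup hyp.growth hω hG).mono_exponent hlam
    hpq.symm.pos hq, hu.1.state, hπ, hπ.transversality hyp.growth hω hG,
    hyp.maximum_of_isOptimal hp hω hlam hu hπ⟩

end Necessity

end BoundaryControl

end

theorem mainTheorem1
    {V : Type*} [NormedAddCommGroup V] [InnerProductSpace ℝ V] [CompleteSpace V]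
    [TopologicalSpace.SeparableSpace V]
    {U : Type*} [NormedAddCommGroup U] [InnerProductSpace ℝ U] [CompleteSpace U]
    [TopologicalSpace.SeparableSpace U]
    (A : StrongDual ℝ V →ₗ.[ℝ] StrongDual ℝ V)
    (S : ℝ → StrongDual ℝ V →L[ℝ] StrongDual ℝ V)
    (B : U →L[ℝ] StrongDual ℝ V)
    (g₀ : StrongDual ℝ V → ℝ) (h₀ : U → ℝ) (p q ω lam : ℝ)
    (hyp : BoundaryControl.StandingAssumptions A S g₀ h₀ p ω lam)
    (hp : 2 ≤ p) (hq : q = p / (p - 1)) (hlam : max (2 * ω) ω < lam)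
    (t : ℝ) (ht : 0 ≤ t) (x : StrongDual ℝ V) :
    (∀ (u : ℝ → U) (y : ℝ → StrongDual ℝ V),
      BoundaryControl.IsAdmissible S B g₀ h₀ p lam t x u y →
      (∃ π : ℝ → V, BoundaryControl.MemWeightedLp q lam t π ∧
        BoundaryControl.SolvesOptimalitySystem S B g₀ h₀ ω lam t x u y π) →
      BoundaryControl.IsOptimal S B g₀ h₀ p lam t x u y) ∧
    ((2 < p ∧ 0 < lam) ∨ (p = 2 ∧ 0 < lam ∧ ω < 0) →
      ∀ (u : ℝ → U) (y : ℝ → StrongDual ℝ V),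
        BoundaryControl.IsOptimal S B g₀ h₀ p lam t x u y →
        ∃ π : ℝ → V, BoundaryControl.MemWeightedLp q lam t π ∧
          BoundaryControl.SolvesOptimalitySystem S B g₀ h₀ ω lam t x u y π) := by
  have hpq : p.HolderConjugate q := (Real.holderConjugate_iff_eq_conjExponent (by linarith)).2 hq
  have hω : 2 * ω < lam := (le_max_left _ _).trans_lt hlam
  refine ⟨fun u y hu ⟨π, hπq, hsol⟩ =>
    hyp.isOptimal_of_solvesOptimalitySystem hp hpq hω hu hπq hsol, fun hcase u y hu => ?_⟩
  have hlam0 : 0 < lam := by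
    rcases hcase with h | h
    · exact h.2
    · exact h.2.1
  exact hyp.exists_costate_of_isOptimal hp hpq hω hlam0 hu
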